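/- Let $U$ be a unitary operator on $\mathbb C^2\otimes\mathbb C^2$ (system qubit $\otimes$ memory qubit). A sequence of input states $\varrho_1,\varrho_2,\dots$ of the system and an initial memory state $\xi_1$ determine memory states by $\xi_{n+1}=\mathrm{tr}_{\rm sys}[U(\varrho_n\otimes\xi_n)U^\dagger]$, and the $n$th input is transformed by the channel $\mathcal E_n[\varrho]=\mathrm{tr}_{\rm mem}[U(\varrho\otimes\xi_n)U^\dagger]$. The memory depth $\Delta_U\in\{0,1,2,\dots\}\cup\{\infty\}$ is the least $\Delta\ge 0$ such that for every $n>\Delta$ the channel $\mathcal E_n$ depends neither on the initial memory state $\xi_1$ nor on the inputs $\varrho_j$ with $j<n-\Delta$; $\Delta_U=\infty$ if there is no such $\Delta$. Write $\sigma_{jj}=\sigma_j\otimes\sigma_j$ for the Pauli operators $\sigma_x,\sigma_y,\sigma_z$, and for real $\alpha$ and $h_x,h_y\in\{0,1\}$ put $$U_{\alpha}^{(h_x,h_y)}=\tfrac12\bigl[I+\sigma_{zz}+i e^{-2i\alpha}(\sigma_{xx}+\sigma_{yy})\bigr]\sigma_{xx}^{h_x}\sigma_{yy}^{h_y}.$$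 Then the values taken by $\Delta_U$, as $U$ ranges over all two-qubit unitaries, are exactly $0,1,2,\infty$. Moreover, for every two-qubit unitary $U$: 1. $\Delta_U=0$ if and only if $U=V\otimes W$ for some single-qubit unitaries $V,W$. 2. $\Delta_U=1$ if and only if $U=(V_1\otimes W_1)V_{\rm swap}(V_2\otimes W_2)$ for some single-qubit unitaries $V_1,W_1,V_2,W_2$, where $V_{\rm swap}$ exchanges the two qubits. 3. $\Delta_U=2$ if and only if $$U=(V_1\otimes W_2^\dagger W')\,U_{\alpha}^{(h_x,h_y)}\,(V_2\otimes W_2)$$ for some single-qubit unitaries $V_1,V_2,W_2$, some $h_x,h_y\in\{0,1\}$, some real $\alpha$ with $\cos 2\alpha\ne 0$, and some $$W'=\begin{pmatrix}0&1\\-1&0\end{pmatrix}^{p}\begin{pmatrix}e^{i\beta}&0\\0&e^{-i\beta}\end{pmatrix},\qquad p\in\{0,1\},\ \beta\in[0,2\pi].$$ Equivalently, $\Delta_U=2$ if and only if $U=(V_1\otimes W_2^\dagger W')\exp\bigl(i\sum_j\alpha_j\sigma_{jj}\bigr)(V_2\otimes W_2)$ for some single-qubit unitaries $V_1,V_2,W_2,W'$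 and real $\alpha_x,\alpha_y,\alpha_z$ such that for some $k\in\{x,y,z\}$ one has $\alpha_j\in\{\pi/4,-\pi/4\}$ for both $j\ne k$, $\cos 2\alpha_k\neq0$, and $W'\sigma_kW'^\dagger=\pm\sigma_k$. 4. $\Delta_U=\infty$ if and only if $U$ has none of the forms in 1, 2 and 3. The two families in 3 are related as follows: if $\alpha_x,\alpha_y\in\{\pi/4,-\pi/4\}$ and $\alpha_z\in\mathbb R$, then $$\exp\Bigl(i\sum_j\alpha_j\sigma_{jj}\Bigr)=e^{i\alpha_z}(-i)^{h_x+h_y}\,U_{\alpha_z}^{(h_x,h_y)},$$ where $h_j=1$ if $\alpha_j=-\pi/4$ and $h_j=0$ if $\alpha_j=\pi/4$. -/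

import Mathlib

open Matrix Complex
open scoped Kronecker ComplexOrder

section QuantumMemoryChannels

variable {S M : Type*} [Fintype S] [Fintype M]

/-- Density operators on the finite-dimensional Hilbert space with orthonormal basis `S`. -/
def IsState (ρ : Matrix S S ℂ) : Prop :=
  ρ.PosSemidef ∧ ρ.trace = 1

/-- Partial trace over the memory; operators on system `⊗` memory are indexed by `S × M`. -/
def traceMem : Matrix (S × M) (S × M) ℂ →ₗ[ℂ] Matrix S S ℂ where
  toFun X := Matrix.of fun i j => ∑ a, X (i, a) (j, a)
  map_add' X Y := by ext i j; simp [Finset.sum_add_distrib]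
  map_smul' c X := by ext i j; simp [Finset.mul_sum]

/-- Partial trace over the system. -/
def traceSys : Matrix (S × M) (S × M) ℂ →ₗ[ℂ] Matrix M M ℂ where
  toFun X := Matrix.of fun a b => ∑ i, X (i, a) (i, b)
  map_add' X Y := by ext i j; simp [Finset.sum_add_distrib]
  map_smul' c X := by ext i j; simp [Finset.mul_sum]

/-- The map `ϱ ↦ tr_mem [U (ϱ ⊗ ξ) U†]` on the system when the memory is in the state `ξ`. -/
def systemChannel (U : Matrix (S × M) (S × M) ℂ) (ξ : Matrix M M ℂ) :
    Matrix S S ℂ →ₗ[ℂ] Matrix S S ℂ where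
  toFun ρ := traceMem (U * (ρ ⊗ₖ ξ) * Uᴴ)
  map_add' ρ σ := by simp [add_kronecker, mul_add, add_mul]
  map_smul' c ρ := by simp [smul_kronecker]

/-- The concurrent map `ξ ↦ tr_sys [U (ϱ ⊗ ξ) U†]` on the memory when the input is `ϱ`. -/
def concurrentChannel (U : Matrix (S × M) (S × M) ℂ) (ρ : Matrix S S ℂ) :
    Matrix M M ℂ →ₗ[ℂ] Matrix M M ℂ where
  toFun ξ := traceSys (U * (ρ ⊗ₖ ξ) * Uᴴ)
  map_add' ξ η := by simp [kronecker_add, mul_add, add_mul]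
  map_smul' c ξ := by simp [kronecker_smul]

/-- State of the memory after the inputs `ρ 0, …, ρ (n - 1)`, starting from `ξ`. -/
def memoryState (U : Matrix (S × M) (S × M) ℂ) (ρ : ℕ → Matrix S S ℂ) (ξ : Matrix M M ℂ) :
    ℕ → Matrix M M ℂ
  | 0 => ξ
  | n + 1 => concurrentChannel U (ρ n) (memoryState U ρ ξ n)

/-- The map that transforms the input `ρ n`; the run with input `ρ n` is preceded by `n` runs. -/
def runChannel (U : Matrix (S × M) (S × M) ℂ) (ρ : ℕ → Matrix S S ℂ) (ξ : Matrix M M ℂ) (n : ℕ) :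
    Matrix S S ℂ →ₗ[ℂ] Matrix S S ℂ :=
  systemChannel U (memoryState U ρ ξ n)

/-- In every run preceded by at least `Δ` runs, the map that transforms the current input
depends on none of the data other than the last `Δ` inputs: neither on the initial state of the
memory nor on any earlier input. -/
def ForgetsAfter (U : Matrix (S × M) (S × M) ℂ) (Δ : ℕ) : Prop :=
  ∀ n : ℕ, Δ ≤ n → ∀ (ρ ρ' : ℕ → Matrix S S ℂ) (ξ ξ' : Matrix M M ℂ),
    (∀ j, IsState (ρ j)) → (∀ j, IsState (ρ' j)) → IsState ξ → IsState ξ' →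
    (∀ j, n - Δ ≤ j → j < n → ρ j = ρ' j) →
    runChannel U ρ ξ n = runChannel U ρ' ξ' n

/-- The depth of the memory: the least `Δ` with `ForgetsAfter U Δ`, and `∞` if there is none. -/
noncomputable def memoryDepth (U : Matrix (S × M) (S × M) ℂ) : ℕ∞ :=
  sInf {d : ℕ∞ | ∃ Δ : ℕ, d = Δ ∧ ForgetsAfter U Δ}

end QuantumMemoryChannels

/-- Operators on a qubit. -/
abbrev QubitOp := Matrix (Fin 2) (Fin 2) ℂ

/-- Operators on system qubit `⊗` memory qubit. -/
abbrev TwoQubitOp := Matrix (Fin 2 × Fin 2) (Fin 2 × Fin 2) ℂ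

/-- The Pauli operators `σ_x, σ_y, σ_z`, numbered `0, 1, 2`. -/
def pauli : Fin 3 → QubitOp :=
  ![!![0, 1; 1, 0], !![0, -I; I, 0], !![1, 0; 0, -1]]

/-- `σ_jj = σ_j ⊗ σ_j`. -/
def pauliPair (j : Fin 3) : TwoQubitOp :=
  pauli j ⊗ₖ pauli j

/-- `exp (i ∑ⱼ αⱼ σⱼ ⊗ σⱼ)`. -/
noncomputable def canonicalGate (α : Fin 3 → ℝ) : TwoQubitOp :=
  NormedSpace.exp (I • ∑ j, (α j : ℂ) • pauliPair j)

/-- The exchange of the two qubits. -/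
def swapGate : TwoQubitOp :=
  Matrix.of fun p q => if p.1 = q.2 ∧ p.2 = q.1 then 1 else 0

/-- `½ [I + σ_zz + i e^{-2iα} (σ_xx + σ_yy)] σ_xx^{h_x} σ_yy^{h_y}`. -/
noncomputable def finiteDepthGate (α : ℝ) (hx hy : Fin 2) : TwoQubitOp :=
  (1 / 2 : ℂ) •
    (1 + pauliPair 2 + (I * Complex.exp (-2 * I * α)) • (pauliPair 0 + pauliPair 1)) *
    pauliPair 0 ^ (hx : ℕ) * pauliPair 1 ^ (hy : ℕ)

/-- The local rotation `W'` of the memory: `e^{iβσ_z}`, multiplied on the left by `(0 1; -1 0)` if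
`p = 1`. -/
noncomputable def memoryRotation (p : Fin 2) (β : ℝ) : QubitOp :=
  !![0, 1; -1, 0] ^ (p : ℕ) *
    !![Complex.exp (I * β), 0; 0, Complex.exp (-(I * β))]

/-- `U = V ⊗ W` with unitary `V`, `W`. -/
def IsFactorized (U : TwoQubitOp) : Prop :=
  ∃ V ∈ unitaryGroup (Fin 2) ℂ, ∃ W ∈ unitaryGroup (Fin 2) ℂ, U = V ⊗ₖ W

/-- `U` is the swap up to local unitaries. -/
def IsLocallySwap (U : TwoQubitOp) : Prop :=
  ∃ V₁ ∈ unitaryGroup (Fin 2) ℂ, ∃ W₁ ∈ unitaryGroup (Fin 2) ℂ,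
  ∃ V₂ ∈ unitaryGroup (Fin 2) ℂ, ∃ W₂ ∈ unitaryGroup (Fin 2) ℂ,
    U = (V₁ ⊗ₖ W₁) * swapGate * (V₂ ⊗ₖ W₂)

/-- `U = (V₁ ⊗ W₂† W') U_α (V₂ ⊗ W₂)`, where `U_α` is not the swap up to local unitaries. -/
def IsDepthTwoForm (U : TwoQubitOp) : Prop :=
  ∃ V₁ ∈ unitaryGroup (Fin 2) ℂ, ∃ V₂ ∈ unitaryGroup (Fin 2) ℂ,
  ∃ W₂ ∈ unitaryGroup (Fin 2) ℂ, ∃ α : ℝ, ∃ hx hy p : Fin 2, ∃ β ∈ Set.Icc 0 (2 * Real.pi),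
    Real.cos (2 * α) ≠ 0 ∧
    U = (V₁ ⊗ₖ (W₂ᴴ * memoryRotation p β)) * finiteDepthGate α hx hy * (V₂ ⊗ₖ W₂)

/-- `U = (V₁ ⊗ W₂† W') exp (i ∑ⱼ αⱼ σⱼ ⊗ σⱼ) (V₂ ⊗ W₂)`, where the two coefficients other than
`α_k` equal `±π/4`, `cos 2α_k ≠ 0`, and the rotation `W'` maps the `k`-axis of the Bloch ball
to itself. -/
def IsDepthTwoExpForm (U : TwoQubitOp) : Prop :=
  ∃ V₁ ∈ unitaryGroup (Fin 2) ℂ, ∃ V₂ ∈ unitaryGroup (Fin 2) ℂ,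
  ∃ W₂ ∈ unitaryGroup (Fin 2) ℂ, ∃ W' ∈ unitaryGroup (Fin 2) ℂ,
  ∃ (α : Fin 3 → ℝ) (k : Fin 3),
    (∀ j, j ≠ k → α j = Real.pi / 4 ∨ α j = -(Real.pi / 4)) ∧
    Real.cos (2 * α k) ≠ 0 ∧
    (W' * pauli k * W'ᴴ = pauli k ∨ W' * pauli k * W'ᴴ = -pauli k) ∧
    U = (V₁ ⊗ₖ (W₂ᴴ * W')) * canonicalGate α * (V₂ ⊗ₖ W₂)

/-- The Heaviside step `H(-a)`: `1` for `a < 0` and `0` for `a > 0`. -/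
noncomputable def negStep (a : ℝ) : Fin 2 :=
  if a < 0 then 1 else 0

/-!
Memory depth of a two-qubit unitary. In the Heisenberg picture a memory observable `Y`, after one
run with input `ρ`, becomes `tr_sys [(ρ ⊗ 1) U† (1 ⊗ Y) U]`, and the action of a run on its input
is read off from the memory observables `tr_sys [(ρ ⊗ 1) U† (A ⊗ 1) U]`. If the depth is finite,
every observable of the second kind becomes a scalar after finitely many backward runs. Either all
of them are scalars already, so that `U† (A ⊗ 1) U` is always a system observable and `U` is
factorized (`isFactorized_of_forall_intertwine`), or somewhere along a chain of backward runs there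
is a `Y` that is not a scalar although its image under every input is one
(`IsBlind.exists_effectiveObs_scalar`). Then `U† (1 ⊗ Y) U = Z ⊗ 1`. One may take `Y` and `Z`
to be `σ_z` in suitable bases, and `U` composed with the swap becomes a controlled unitary, so
that `U = (V₁ ⊗ W₁) F_c (V₂ ⊗ W₂)` with `F_c` the swap times `diag (1, c, c, 1)`, `|c| = 1`
(`exists_phaseSwap_form`). No general canonical decomposition of two-qubit gates is needed.

For such a gate the channel acting on the input determines the memory state
(`systemChannel_phaseSwapForm_injective`), so the depth is the number of runs that erase every
traceless memory operator. One run turns `X` into a multiple of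
`(c̄ - c) (W₂ X W₂†)₀₀ · W₁ (0 r; -r̄ 0) W₁†`, with `r` the coherence of the rotated input
(`concurrentChannel_phaseSwapForm`). If `c = ±1` this vanishes, the depth is one, and the gate is
locally the swap. Otherwise one run does not suffice. Two runs suffice if `W₂ W₁` is diagonal or
antidiagonal; if it is not, an input with suitable coherence multiplies `(W₂ X W₂†)₀₀` by a fixed
nonzero factor in every run, and the depth is infinite (`not_forgetsAfter_phaseSwapForm`).

It remains to see that the two descriptions of depth two are parametrizations of the gates with
`c ≠ ±1` and `W₂ W₁` diagonal or antidiagonal (`isDepthTwoForm_iff`, `isDepthTwoExpForm_iff`).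
The canonical gate is diagonalized by the Bell states, and the three axes are permuted cyclically
by a local rotation (`canonicalGate_shift`).
-/

/-! ### Partial traces -/

section PartialTrace

variable {S M : Type*} [Fintype S] [Fintype M]

lemma trace_mul_traceSys [DecidableEq S] (Y : Matrix M M ℂ) (X : Matrix (S × M) (S × M) ℂ) :
    (Y * traceSys X).trace = (((1 : Matrix S S ℂ) ⊗ₖ Y) * X).trace := by
  simp only [Matrix.trace, Matrix.diag, Matrix.mul_apply, traceSys, LinearMap.coe_mk,
    AddHom.coe_mk, Matrix.of_apply, Fintype.sum_prod_type, kroneckerMap_apply, Matrix.one_apply,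
    ite_mul, one_mul, zero_mul, Finset.mul_sum]
  simp only [Finset.sum_ite_irrel, Finset.sum_const_zero, Finset.sum_ite_eq, Finset.mem_univ,
    if_true]
  rw [Finset.sum_comm (s := (Finset.univ : Finset S))]
  exact Finset.sum_congr rfl fun a _ => Finset.sum_comm

lemma trace_mul_traceMem [DecidableEq M] (A : Matrix S S ℂ) (X : Matrix (S × M) (S × M) ℂ) :
    (A * traceMem X).trace = ((A ⊗ₖ (1 : Matrix M M ℂ)) * X).trace := by
  simp only [Matrix.trace, Matrix.diag, Matrix.mul_apply, traceMem, LinearMap.coe_mk,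
    AddHom.coe_mk, Matrix.of_apply, Fintype.sum_prod_type, kroneckerMap_apply, Matrix.one_apply,
    mul_ite, mul_one, mul_zero, ite_mul, zero_mul, Finset.mul_sum, Finset.sum_ite_eq,
    Finset.mem_univ, if_true]
  exact Finset.sum_congr rfl fun a _ => Finset.sum_comm

lemma trace_traceSys (X : Matrix (S × M) (S × M) ℂ) : (traceSys X).trace = X.trace := by
  simp only [Matrix.trace, Matrix.diag, traceSys, LinearMap.coe_mk, AddHom.coe_mk,
    Matrix.of_apply, Fintype.sum_prod_type]
  exact Finset.sum_comm

lemma traceSys_kronecker_conj [DecidableEq S] {V : Matrix S S ℂ} (hV : V ∈ unitaryGroup S ℂ)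
    (W : Matrix M M ℂ) (X : Matrix (S × M) (S × M) ℂ) :
    traceSys ((V ⊗ₖ W) * X * (V ⊗ₖ W)ᴴ) = W * traceSys X * Wᴴ := by
  have hV' : Vᴴ * V = 1 := mem_unitaryGroup_iff'.1 hV
  refine Matrix.ext_iff_trace_mul_left.2 fun Y => ?_
  calc (Y * traceSys ((V ⊗ₖ W) * X * (V ⊗ₖ W)ᴴ)).trace
      = (((V ⊗ₖ W)ᴴ * ((1 : Matrix S S ℂ) ⊗ₖ Y) * (V ⊗ₖ W)) * X).trace := by
        rw [trace_mul_traceSys, ← Matrix.mul_assoc, Matrix.trace_mul_comm]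
        simp only [Matrix.mul_assoc]
    _ = ((Wᴴ * Y * W) * traceSys X).trace := by
        rw [trace_mul_traceSys, conjTranspose_kronecker, ← mul_kronecker_mul,
          ← mul_kronecker_mul, Matrix.mul_one, hV']
    _ = (Y * (W * traceSys X * Wᴴ)).trace := by
        rw [Matrix.mul_assoc, Matrix.mul_assoc, Matrix.trace_mul_comm]
        simp only [Matrix.mul_assoc]

lemma traceMem_kronecker_conj [DecidableEq M] (V : Matrix S S ℂ) {W : Matrix M M ℂ}
    (hW : W ∈ unitaryGroup M ℂ) (X : Matrix (S × M) (S × M) ℂ) :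
    traceMem ((V ⊗ₖ W) * X * (V ⊗ₖ W)ᴴ) = V * traceMem X * Vᴴ := by
  have hW' : Wᴴ * W = 1 := mem_unitaryGroup_iff'.1 hW
  refine Matrix.ext_iff_trace_mul_left.2 fun Y => ?_
  calc (Y * traceMem ((V ⊗ₖ W) * X * (V ⊗ₖ W)ᴴ)).trace
      = (((V ⊗ₖ W)ᴴ * (Y ⊗ₖ (1 : Matrix M M ℂ)) * (V ⊗ₖ W)) * X).trace := by
        rw [trace_mul_traceMem, ← Matrix.mul_assoc, Matrix.trace_mul_comm]
        simp only [Matrix.mul_assoc]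
    _ = ((Vᴴ * Y * V) * traceMem X).trace := by
        rw [trace_mul_traceMem, conjTranspose_kronecker, ← mul_kronecker_mul,
          ← mul_kronecker_mul, Matrix.mul_one, hW']
    _ = (Y * (V * traceMem X * Vᴴ)).trace := by
        rw [Matrix.mul_assoc, Matrix.mul_assoc, Matrix.trace_mul_comm]
        simp only [Matrix.mul_assoc]

end PartialTrace

/-! ### Memory observables in the Heisenberg picture -/

section Heisenberg

variable {S M : Type*} [Fintype S] [Fintype M]

lemma memoryState_congr (U : Matrix (S × M) (S × M) ℂ) {ρ ρ' : ℕ → Matrix S S ℂ}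
    (ξ : Matrix M M ℂ) {n : ℕ} (h : ∀ j < n, ρ j = ρ' j) :
    memoryState U ρ ξ n = memoryState U ρ' ξ n := by
  induction n with
  | zero => rfl
  | succ n ih =>
    rw [memoryState, memoryState, ih fun j hj => h j (hj.trans n.lt_succ_self), h n n.lt_succ_self]

lemma memoryState_sub (U : Matrix (S × M) (S × M) ℂ) (ρ : ℕ → Matrix S S ℂ)
    (ξ ξ' : Matrix M M ℂ) (n : ℕ) :
    memoryState U ρ ξ n - memoryState U ρ ξ' n = memoryState U ρ (ξ - ξ') n := by
  induction n with
  | zero => rfl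
  | succ n ih => simp only [memoryState]; rw [← map_sub, ih]

variable [DecidableEq S] [DecidableEq M]

/-- The effective memory observable of a joint observable `X` when the system is prepared in `ρ`:
`tr_sys [(ρ ⊗ 1) X]`. -/
def effectiveObs (ρ : Matrix S S ℂ) (X : Matrix (S × M) (S × M) ℂ) : Matrix M M ℂ :=
  traceSys ((ρ ⊗ₖ (1 : Matrix M M ℂ)) * X)

lemma trace_mul_conj_kronecker (U X : Matrix (S × M) (S × M) ℂ) (ρ : Matrix S S ℂ)
    (ξ : Matrix M M ℂ) :
    (X * (U * (ρ ⊗ₖ ξ) * Uᴴ)).trace = (effectiveObs ρ (Uᴴ * X * U) * ξ).trace := by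
  have h : ρ ⊗ₖ ξ = ((1 : Matrix S S ℂ) ⊗ₖ ξ) * (ρ ⊗ₖ (1 : Matrix M M ℂ)) := by
    rw [← mul_kronecker_mul, Matrix.one_mul, Matrix.mul_one]
  rw [Matrix.trace_mul_comm _ ξ, effectiveObs, trace_mul_traceSys, ← Matrix.mul_assoc _ _ (_ * _),
    ← h, ← Matrix.mul_assoc, ← Matrix.mul_assoc, Matrix.trace_mul_comm _ Uᴴ, ← Matrix.mul_assoc,
    ← Matrix.mul_assoc, Matrix.trace_mul_comm _ (ρ ⊗ₖ ξ)]

lemma trace_mul_concurrentChannel (U : Matrix (S × M) (S × M) ℂ) (ρ : Matrix S S ℂ)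
    (Y ξ : Matrix M M ℂ) :
    (Y * concurrentChannel U ρ ξ).trace =
      (effectiveObs ρ (Uᴴ * ((1 : Matrix S S ℂ) ⊗ₖ Y) * U) * ξ).trace := by
  rw [← trace_mul_conj_kronecker, ← trace_mul_traceSys]; rfl

lemma trace_mul_systemChannel (U : Matrix (S × M) (S × M) ℂ) (ρ A : Matrix S S ℂ)
    (ξ : Matrix M M ℂ) :
    (A * systemChannel U ξ ρ).trace =
      (effectiveObs ρ (Uᴴ * (A ⊗ₖ (1 : Matrix M M ℂ)) * U) * ξ).trace := by
  rw [← trace_mul_conj_kronecker, ← trace_mul_traceMem]; rfl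

lemma trace_concurrentChannel {U : Matrix (S × M) (S × M) ℂ} (hU : U ∈ unitaryGroup (S × M) ℂ)
    {ρ : Matrix S S ℂ} (hρ : IsState ρ) (ξ : Matrix M M ℂ) :
    (concurrentChannel U ρ ξ).trace = ξ.trace := by
  have hU' : Uᴴ * U = 1 := mem_unitaryGroup_iff'.1 hU
  have h := trace_traceSys (U * (ρ ⊗ₖ ξ) * Uᴴ)
  rw [Matrix.trace_mul_comm, ← Matrix.mul_assoc, hU', Matrix.one_mul, trace_kronecker, hρ.2,
    one_mul] at h
  exact h

lemma trace_memoryState {U : Matrix (S × M) (S × M) ℂ} (hU : U ∈ unitaryGroup (S × M) ℂ)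
    {ρ : ℕ → Matrix S S ℂ} (hρ : ∀ j, IsState (ρ j)) (ξ : Matrix M M ℂ) (n : ℕ) :
    (memoryState U ρ ξ n).trace = ξ.trace := by
  induction n with
  | zero => rfl
  | succ n ih => rw [memoryState, trace_concurrentChannel hU (hρ n), ih]

/-- After `k` runs the expectation of the memory observable `Y` does not depend on the initial
memory state. -/
def IsBlind (U : Matrix (S × M) (S × M) ℂ) (k : ℕ) (Y : Matrix M M ℂ) : Prop :=
  ∀ (ρ : ℕ → Matrix S S ℂ) (ξ ξ' : Matrix M M ℂ), (∀ j, IsState (ρ j)) → IsState ξ → IsState ξ' →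
    (Y * memoryState U ρ ξ k).trace = (Y * memoryState U ρ ξ' k).trace

lemma IsBlind.effectiveObs {U : Matrix (S × M) (S × M) ℂ} {k : ℕ} {Y : Matrix M M ℂ}
    (h : IsBlind U (k + 1) Y) {σ : Matrix S S ℂ} (hσ : IsState σ) :
    IsBlind U k (effectiveObs σ (Uᴴ * ((1 : Matrix S S ℂ) ⊗ₖ Y) * U)) := by
  intro ρ ξ ξ' hρ hξ hξ'
  have key := h (Function.update ρ k σ) ξ ξ' (fun j => by
    rcases eq_or_ne j k with rfl | hj
    · simpa using hσ
    · simpa [hj] using hρ j) hξ hξ'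
  have hcongr (ζ : Matrix M M ℂ) :
      memoryState U (Function.update ρ k σ) ζ k = memoryState U ρ ζ k :=
    memoryState_congr U ζ fun j hj => Function.update_of_ne hj.ne _ _
  simpa only [memoryState, Function.update_self, trace_mul_concurrentChannel, hcongr] using key

lemma ForgetsAfter.isBlind {U : Matrix (S × M) (S × M) ℂ} {Δ : ℕ} (h : ForgetsAfter U Δ)
    (A σ : Matrix S S ℂ) :
    IsBlind U Δ (effectiveObs σ (Uᴴ * (A ⊗ₖ (1 : Matrix M M ℂ)) * U)) := by
  intro ρ ξ ξ' hρ hξ hξ'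
  have key := h Δ le_rfl ρ ρ ξ ξ' hρ hρ hξ hξ' fun _ _ _ => rfl
  rw [← trace_mul_systemChannel, ← trace_mul_systemChannel]
  exact congrArg (fun E : Matrix S S ℂ →ₗ[ℂ] Matrix S S ℂ => (A * E σ).trace) key

/-- Followed backwards in time, a blind observable that is not a scalar must become a scalar at
some run, whatever the input of that run. -/
lemma IsBlind.exists_effectiveObs_scalar {U : Matrix (S × M) (S × M) ℂ}
    (h0 : ∀ Y, IsBlind U 0 Y → ∃ c : ℂ, Y = c • 1) {k : ℕ} {Y : Matrix M M ℂ}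
    (hY : IsBlind U k Y) (hns : ¬ ∃ c : ℂ, Y = c • 1) :
    ∃ Y' : Matrix M M ℂ, (¬ ∃ c : ℂ, Y' = c • 1) ∧ ∀ σ : Matrix S S ℂ, IsState σ →
      ∃ c : ℂ, _root_.effectiveObs σ (Uᴴ * ((1 : Matrix S S ℂ) ⊗ₖ Y') * U) = c • 1 := by
  induction k generalizing Y with
  | zero => exact absurd (h0 Y hY) hns
  | succ k ih =>
    by_cases hall : ∀ σ : Matrix S S ℂ, IsState σ →
        ∃ c : ℂ, _root_.effectiveObs σ (Uᴴ * ((1 : Matrix S S ℂ) ⊗ₖ Y) * U) = c • 1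
    · exact ⟨Y, hns, hall⟩
    · push Not at hall
      obtain ⟨σ, hσ, hc⟩ := hall
      exact ih (hY.effectiveObs hσ) fun ⟨c, hc'⟩ => hc c hc'

end Heisenberg

/-! ### States of a qubit -/

section QubitStates

/-- For `|r| = 1`, the pure state `½ (|0⟩ + r̄ |1⟩)(⟨0| + r ⟨1|)` on the equator of the Bloch
ball. -/
noncomputable def equatorState (r : ℂ) : QubitOp := !![1 / 2, r / 2; star r / 2, 1 / 2]

lemma isState_equatorState {r : ℂ} (hr : star r * r = 1) : IsState (equatorState r) := by
  refine ⟨?_, ?_⟩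
  · have h : equatorState r = (1 / 2 : ℂ) • vecMulVec ![1, star r] (star ![1, star r]) := by
      ext i j
      rw [Matrix.smul_apply, vecMulVec_apply]
      fin_cases i <;> fin_cases j <;> simp [equatorState] at hr ⊢
      · ring
      · ring
      · rw [hr]
    rw [h]
    exact (posSemidef_vecMulVec_self_star _).smul (by simp)
  · simp [equatorState, Matrix.trace_fin_two]
    norm_num

lemma isState_single (i : Fin 2) : IsState (Matrix.single i i (1 : ℂ)) := by
  refine ⟨?_, by simp⟩
  rw [← Matrix.diagonal_single]
  refine PosSemidef.diagonal fun j => ?_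
  rcases eq_or_ne j i with rfl | h <;> simp [*]

/-- The states of a qubit span its operators. -/
lemma QubitOp.induction_on_states {p : QubitOp → Prop} (hadd : ∀ A B, p A → p B → p (A + B))
    (hsmul : ∀ (c : ℂ) A, p A → p (c • A)) (hstate : ∀ ρ, IsState ρ → p ρ) (A : QubitOp) : p A := by
  -- `|0⟩⟨1|` is `equatorState 1 + i equatorState (-i) - (1 + i)/2`, and `|1⟩⟨0|` its adjoint.
  have h : A =
      ((A 0 0 - A 0 1 * (1 + I) / 2 - A 1 0 * (1 - I) / 2) • Matrix.single 0 0 (1 : ℂ) +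
      (A 1 1 - A 0 1 * (1 + I) / 2 - A 1 0 * (1 - I) / 2) • Matrix.single 1 1 (1 : ℂ)) +
      ((A 0 1 + A 1 0) • equatorState 1 + (I * (A 0 1 - A 1 0)) • equatorState (-I)) := by
    ext i j
    fin_cases i <;> fin_cases j <;> simp [equatorState] <;> ring_nf <;> simp <;> ring
  rw [h]
  refine hadd _ _ (hadd _ _ ?_ ?_) (hadd _ _ ?_ ?_) <;> refine hsmul _ _ (hstate _ ?_)
  · exact isState_single 0
  · exact isState_single 1
  · exact isState_equatorState (by simp)
  · exact isState_equatorState (by simp)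

/-- An observable with the same expectation in all states is a scalar. -/
lemma scalar_of_trace_mul_const {Y : QubitOp}
    (h : ∀ ξ ξ', IsState ξ → IsState ξ' → (Y * ξ).trace = (Y * ξ').trace) :
    ∃ c : ℂ, Y = c • 1 := by
  refine ⟨(Y * Matrix.single 0 0 (1 : ℂ)).trace, Matrix.ext_iff_trace_mul_right.2 fun ξ => ?_⟩
  refine QubitOp.induction_on_states
    (p := fun ξ => (Y * ξ).trace = (((Y * Matrix.single 0 0 (1 : ℂ)).trace • 1) * ξ).trace)
    ?_ ?_ ?_ ξ
  · intro A B hA hB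
    rw [Matrix.mul_add, Matrix.mul_add, Matrix.trace_add, Matrix.trace_add, hA, hB]
  · intro c A hA
    rw [Matrix.mul_smul, Matrix.mul_smul, Matrix.trace_smul, Matrix.trace_smul, hA]
  · intro ρ hρ
    rw [h ρ _ hρ (isState_single 0)]
    simp [hρ.2]

/-- A joint observable whose effective memory observables are all scalar acts on the system
alone. -/
lemma exists_eq_kronecker_one {X : TwoQubitOp}
    (h : ∀ ρ : QubitOp, IsState ρ → ∃ c : ℂ, effectiveObs ρ X = c • 1) :
    ∃ Z : QubitOp, X = Z ⊗ₖ 1 := by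
  have hall : ∀ ρ : QubitOp, ∃ c : ℂ, effectiveObs ρ X = c • 1 := by
    refine QubitOp.induction_on_states ?_ ?_ h
    · rintro A B ⟨a, ha⟩ ⟨b, hb⟩
      refine ⟨a + b, ?_⟩
      rw [add_smul, ← ha, ← hb]
      simp [effectiveObs, add_kronecker, Matrix.add_mul]
    · rintro c A ⟨a, ha⟩
      refine ⟨c * a, ?_⟩
      rw [mul_smul, ← ha]
      simp [effectiveObs, smul_kronecker]
  choose z hz using fun i j : Fin 2 => hall (Matrix.single j i 1)
  refine ⟨Matrix.of z, ?_⟩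
  ext ⟨i, a⟩ ⟨j, b⟩
  have := congrFun (congrFun (hz i j) a) b
  simp only [effectiveObs, traceSys, LinearMap.coe_mk, AddHom.coe_mk, Matrix.of_apply,
    Matrix.mul_apply, Fintype.sum_prod_type, kroneckerMap_apply, Matrix.single_apply,
    Matrix.one_apply, Matrix.smul_apply, smul_eq_mul, ite_mul, one_mul, zero_mul, ite_and] at this
  simp only [kroneckerMap_apply, Matrix.of_apply, Matrix.one_apply, ← this]
  simp

end QubitStates

/-! ### Unitary matrices -/

section UnitaryMatrices

lemma conjTranspose_mem_unitaryGroup {n : Type*} [Fintype n] [DecidableEq n] {V : Matrix n n ℂ}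
    (hV : V ∈ unitaryGroup n ℂ) : Vᴴ ∈ unitaryGroup n ℂ := Unitary.star_mem hV

lemma conjTranspose_mul_self_of_mem {n : Type*} [Fintype n] [DecidableEq n] {V : Matrix n n ℂ}
    (hV : V ∈ unitaryGroup n ℂ) : Vᴴ * V = 1 := mem_unitaryGroup_iff'.1 hV

lemma self_mul_conjTranspose_of_mem {n : Type*} [Fintype n] [DecidableEq n] {V : Matrix n n ℂ}
    (hV : V ∈ unitaryGroup n ℂ) : V * Vᴴ = 1 := mem_unitaryGroup_iff.1 hV

lemma smul_mem_unitaryGroup {n : Type*} [Fintype n] [DecidableEq n] {V : Matrix n n ℂ}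
    (hV : V ∈ unitaryGroup n ℂ) {z : ℂ} (hz : star z * z = 1) : z • V ∈ unitaryGroup n ℂ := by
  rw [mem_unitaryGroup_iff', star_smul, smul_mul_smul_comm, mem_unitaryGroup_iff'.1 hV, hz,
    one_smul]

lemma diagonal_mem_unitaryGroup {n : Type*} [Fintype n] [DecidableEq n] {d : n → ℂ} :
    diagonal d ∈ unitaryGroup n ℂ ↔ ∀ i, star (d i) * d i = 1 := by
  rw [mem_unitaryGroup_iff', star_eq_conjTranspose, diagonal_conjTranspose, diagonal_mul_diagonal,
    ← diagonal_one, diagonal_injective.eq_iff, funext_iff]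
  rfl

lemma isHermitian_exists_conj_diagonal {n : Type*} [Fintype n] [DecidableEq n] {H : Matrix n n ℂ}
    (hH : H.IsHermitian) :
    ∃ T ∈ unitaryGroup n ℂ, ∃ d : n → ℂ, H = T * diagonal d * Tᴴ := by
  refine ⟨hH.eigenvectorUnitary, hH.eigenvectorUnitary.2,
    (fun x : ℝ => (x : ℂ)) ∘ hH.eigenvalues, ?_⟩
  conv_lhs => rw [hH.spectral_theorem, Unitary.conjStarAlgAut_apply]
  rfl

lemma mul_conjTranspose_cancel {n : Type*} [Fintype n] [DecidableEq n] {T : Matrix n n ℂ}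
    (hT : T ∈ unitaryGroup n ℂ) {A B : Matrix n n ℂ} (h : A = T * B * Tᴴ) : Tᴴ * A * T = B := by
  have h1 := conjTranspose_mul_self_of_mem hT
  rw [h, Matrix.mul_assoc, Matrix.mul_assoc, h1, Matrix.mul_one, ← Matrix.mul_assoc, h1,
    Matrix.one_mul]

end UnitaryMatrices

/-! ### Diagonalization on a qubit -/

section Qubit

lemma QubitOp.kronecker_sub (A B C : QubitOp) : A ⊗ₖ (B - C) = A ⊗ₖ B - A ⊗ₖ C := by
  ext; simp [mul_sub]

lemma QubitOp.sub_kronecker (A B C : QubitOp) : (A - B) ⊗ₖ C = A ⊗ₖ C - B ⊗ₖ C := by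
  ext; simp [sub_mul]

lemma QubitOp.eq_diagonal_of_commute {D B : QubitOp} {d : Fin 2 → ℂ} (hD : D = diagonal d)
    (hd : d 0 ≠ d 1) (h : D * B = B * D) : B = diagonal ![B 0 0, B 1 1] := by
  subst hD
  have h01 := congrFun (congrFun h 0) 1
  have h10 := congrFun (congrFun h 1) 0
  rw [diagonal_mul, mul_diagonal] at h01 h10
  have e01 : B 0 1 = 0 := by
    rcases mul_eq_zero.1 (show (d 0 - d 1) * B 0 1 = 0 by linear_combination h01) with h | h
    · exact absurd (sub_eq_zero.1 h) hd
    · exact h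
  have e10 : B 1 0 = 0 := by
    rcases mul_eq_zero.1 (show (d 0 - d 1) * B 1 0 = 0 by linear_combination -h10) with h | h
    · exact absurd (sub_eq_zero.1 h) hd
    · exact h
  ext i j
  fin_cases i <;> fin_cases j <;> simp [e01, e10]

lemma QubitOp.diagonal_scalar {d : Fin 2 → ℂ} (hd : d 0 = d 1) :
    (diagonal d : QubitOp) = d 0 • 1 := by
  ext i j
  fin_cases i <;> fin_cases j <;> simp [hd]

/-- The spectral theorem for unitary operators on a qubit. -/
lemma QubitOp.unitary_exists_conj_diagonal {B : QubitOp} (hB : B ∈ unitaryGroup (Fin 2) ℂ) :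
    ∃ R ∈ unitaryGroup (Fin 2) ℂ, ∃ d : Fin 2 → ℂ, (∀ i, star (d i) * d i = 1) ∧
      B = R * diagonal d * Rᴴ := by
  suffices h : ∃ R ∈ unitaryGroup (Fin 2) ℂ, ∃ d : Fin 2 → ℂ, B = R * diagonal d * Rᴴ by
    obtain ⟨R, hR, d, h⟩ := h
    refine ⟨R, hR, d, diagonal_mem_unitaryGroup.1 ?_, h⟩
    rw [← mul_conjTranspose_cancel hR h]
    exact mul_mem (mul_mem (conjTranspose_mem_unitaryGroup hR) hB) hR
  have hBB : B * Bᴴ = Bᴴ * B := by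
    rw [conjTranspose_mul_self_of_mem hB, self_mul_conjTranspose_of_mem hB]
  -- A Hermitian operator commuting with `B` diagonalizes `B`, unless it is a scalar.
  have key : ∀ H : QubitOp, H.IsHermitian → H * B = B * H → (¬ ∃ c : ℂ, H = c • 1) →
      ∃ R ∈ unitaryGroup (Fin 2) ℂ, ∃ d : Fin 2 → ℂ, B = R * diagonal d * Rᴴ := by
    intro H hH hc hns
    obtain ⟨T, hT, d, hd⟩ := isHermitian_exists_conj_diagonal hH
    have hT1 := self_mul_conjTranspose_of_mem hT
    have hd01 : d 0 ≠ d 1 := fun h => hns ⟨d 0, by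
      rw [hd, QubitOp.diagonal_scalar h, Matrix.mul_smul, Matrix.mul_one, Matrix.smul_mul, hT1]⟩
    have hcomm : (Tᴴ * H * T) * (Tᴴ * B * T) = (Tᴴ * B * T) * (Tᴴ * H * T) := by
      calc (Tᴴ * H * T) * (Tᴴ * B * T) = Tᴴ * (H * (T * Tᴴ) * B) * T := by
            simp only [Matrix.mul_assoc]
        _ = Tᴴ * (B * (T * Tᴴ) * H) * T := by rw [hT1, Matrix.mul_one, Matrix.mul_one, hc]
        _ = _ := by simp only [Matrix.mul_assoc]
    have := QubitOp.eq_diagonal_of_commute (mul_conjTranspose_cancel hT hd) hd01 hcomm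
    refine ⟨T, hT, ![(Tᴴ * B * T) 0 0, (Tᴴ * B * T) 1 1], ?_⟩
    rw [← this]
    calc B = (T * Tᴴ) * B * (T * Tᴴ) := by rw [hT1, Matrix.one_mul, Matrix.mul_one]
      _ = _ := by simp only [Matrix.mul_assoc]
  by_cases h1 : ∃ c : ℂ, B + Bᴴ = c • 1
  · by_cases h2 : ∃ c : ℂ, I • (B - Bᴴ) = c • 1
    · obtain ⟨a, ha⟩ := h1
      obtain ⟨b, hb⟩ := h2
      have hBs : B = ((a - I * b) / 2) • 1 := by
        have h3 : B = (1 / 2 : ℂ) • ((B + Bᴴ) - I • (I • (B - Bᴴ))) := by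
          rw [smul_smul, I_mul_I, neg_one_smul]; module
        rw [h3, ha, hb]; module
      refine ⟨1, one_mem _, fun _ => (a - I * b) / 2, ?_⟩
      rw [QubitOp.diagonal_scalar rfl, conjTranspose_one, Matrix.one_mul, Matrix.mul_one]
      exact hBs
    · refine key _ ?_ ?_ h2
      · rw [Matrix.IsHermitian, conjTranspose_smul, conjTranspose_sub, conjTranspose_conjTranspose,
          star_def, conj_I]
        module
      · rw [Matrix.smul_mul, Matrix.mul_smul, Matrix.sub_mul, Matrix.mul_sub, hBB]
  · refine key _ ?_ ?_ h1
    · rw [Matrix.IsHermitian, conjTranspose_add, conjTranspose_conjTranspose, add_comm]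
    · rw [Matrix.add_mul, Matrix.mul_add, hBB]

lemma pauli_mem_unitaryGroup (k : Fin 3) : pauli k ∈ unitaryGroup (Fin 2) ℂ := by
  rw [mem_unitaryGroup_iff']
  ext i j
  fin_cases k <;> fin_cases i <;> fin_cases j <;>
    simp [pauli, Matrix.mul_apply, Matrix.star_eq_conjTranspose]

lemma pauli_conjTranspose (k : Fin 3) : (pauli k)ᴴ = pauli k := by
  ext i j
  fin_cases k <;> fin_cases i <;> fin_cases j <;> simp [pauli]

lemma pauli_mul_self (k : Fin 3) : pauli k * pauli k = 1 := by
  have := conjTranspose_mul_self_of_mem (pauli_mem_unitaryGroup k)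
  rwa [pauli_conjTranspose] at this

lemma pauli_two_eq_diagonal : pauli 2 = diagonal ![1, -1] := by
  ext i j
  fin_cases i <;> fin_cases j <;> simp [pauli]

/-- A traceless Hermitian involution of a qubit is `σ_z` in some orthonormal basis. -/
lemma QubitOp.exists_conj_pauli_two {Z : QubitOp} (hZ : Z.IsHermitian) (hZ2 : Z * Z = 1)
    (htr : Z.trace = 0) : ∃ T ∈ unitaryGroup (Fin 2) ℂ, Z = T * pauli 2 * Tᴴ := by
  obtain ⟨T, hT, d, hd⟩ := isHermitian_exists_conj_diagonal hZ
  have hT1 := conjTranspose_mul_self_of_mem hT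
  have hT2 := self_mul_conjTranspose_of_mem hT
  have hdd := mul_conjTranspose_cancel hT hd
  have h0 : d 0 + d 1 = 0 := by
    rw [hd, Matrix.trace_mul_comm, ← Matrix.mul_assoc, hT1, Matrix.one_mul] at htr
    simpa [Matrix.trace_fin_two] using htr
  have hsq : (diagonal d : QubitOp) * diagonal d = 1 := by
    rw [← hdd]
    calc Tᴴ * Z * T * (Tᴴ * Z * T) = Tᴴ * (Z * (T * Tᴴ) * Z) * T := by
          simp only [Matrix.mul_assoc]
      _ = 1 := by rw [hT2, Matrix.mul_one, hZ2, Matrix.mul_one, hT1]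
  have h1 : d 0 * d 0 = 1 := by
    have := congrFun (congrFun hsq 0) 0
    simpa using this
  rcases mul_self_eq_one_iff.1 h1 with h | h
  · refine ⟨T, hT, ?_⟩
    have : d = ![1, -1] := by
      ext i; fin_cases i
      · exact h
      · simp; linear_combination h0 - h
    rw [pauli_two_eq_diagonal, ← this, hd]
  · refine ⟨T * pauli 0, mul_mem hT (pauli_mem_unitaryGroup 0), ?_⟩
    have : diagonal d = pauli 0 * pauli 2 * pauli 0 := by
      have h' : d 1 = 1 := by linear_combination h0 - h
      ext i j
      fin_cases i <;> fin_cases j <;> simp [pauli, Matrix.mul_apply, h, h']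
    rw [hd, this, conjTranspose_mul, pauli_conjTranspose]
    simp only [Matrix.mul_assoc]

end Qubit

/-! ### The swap -/

section Swap

lemma swapGate_mul_self : swapGate * swapGate = 1 := by
  ext ⟨i, a⟩ ⟨j, b⟩
  simp only [swapGate, Matrix.mul_apply, Fintype.sum_prod_type, Fin.sum_univ_two, Matrix.of_apply]
  fin_cases i <;> fin_cases a <;> fin_cases j <;> fin_cases b <;> simp

lemma swapGate_conjTranspose : swapGateᴴ = swapGate := by
  ext ⟨i, a⟩ ⟨j, b⟩
  simp only [swapGate, Matrix.conjTranspose_apply, Matrix.of_apply]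
  fin_cases i <;> fin_cases a <;> fin_cases j <;> fin_cases b <;> simp

lemma swapGate_mem_unitaryGroup : swapGate ∈ unitaryGroup (Fin 2 × Fin 2) ℂ := by
  rw [mem_unitaryGroup_iff', star_eq_conjTranspose, swapGate_conjTranspose, swapGate_mul_self]

lemma swapGate_mul_kronecker (A B : QubitOp) : swapGate * (A ⊗ₖ B) = (B ⊗ₖ A) * swapGate := by
  ext ⟨i, a⟩ ⟨j, b⟩
  simp only [swapGate, Matrix.mul_apply, Fintype.sum_prod_type, Fin.sum_univ_two, Matrix.of_apply,
    kroneckerMap_apply]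
  fin_cases i <;> fin_cases a <;> fin_cases j <;> fin_cases b <;> simp <;>
    exact mul_comm _ _

end Swap

/-! ### Normal form of gates with finite memory depth -/

section Classification

/-- A unitary commuting with `1 ⊗ σ_z` is controlled by the memory qubit. -/
lemma exists_eq_blockDiagonal {G : TwoQubitOp} (hG : G ∈ unitaryGroup (Fin 2 × Fin 2) ℂ)
    (h : ((1 : QubitOp) ⊗ₖ pauli 2) * G = G * ((1 : QubitOp) ⊗ₖ pauli 2)) :
    ∃ A : Fin 2 → QubitOp, (∀ k, A k ∈ unitaryGroup (Fin 2) ℂ) ∧ G = blockDiagonal A := by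
  have hz : ((1 : QubitOp) ⊗ₖ pauli 2) = diagonal fun p => (![1, -1] : Fin 2 → ℂ) p.2 := by
    rw [pauli_two_eq_diagonal, ← diagonal_one, diagonal_kronecker_diagonal]
    simp
  obtain ⟨A, hGA⟩ : ∃ A : Fin 2 → QubitOp, G = blockDiagonal A := by
    refine ⟨fun k => Matrix.of fun i j => G (i, k) (j, k), ?_⟩
    ext ⟨i, a⟩ ⟨j, b⟩
    have := congrFun (congrFun h (i, a)) (j, b)
    rw [hz, diagonal_mul, mul_diagonal] at this
    rw [blockDiagonal_apply]
    fin_cases a <;> fin_cases b <;> simp at this ⊢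
    · linear_combination this / 2
    · linear_combination -this / 2
  refine ⟨A, fun k => ?_, hGA⟩
  have hu := conjTranspose_mul_self_of_mem hG
  rw [hGA, blockDiagonal_conjTranspose, ← blockDiagonal_mul, ← blockDiagonal_one] at hu
  exact mem_unitaryGroup_iff'.2 (congrFun (blockDiagonal_injective hu) k)

/-- If `1 ⊗ H`, with `H` a traceless Hermitian involution, evolves backwards to an observable
of the system alone, then this observable is a traceless Hermitian involution as well. -/
lemma exists_conj_pauli_two_of_intertwine {U P : TwoQubitOp}
    (hU : U ∈ unitaryGroup (Fin 2 × Fin 2) ℂ) (hP : P.IsHermitian) (hP2 : P * P = 1)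
    (hPtr : P.trace = 0) {Z : QubitOp} (hZ : Uᴴ * P * U = Z ⊗ₖ 1) :
    ∃ T ∈ unitaryGroup (Fin 2) ℂ, P * (U * (T ⊗ₖ 1)) = U * (T ⊗ₖ 1) * (pauli 2 ⊗ₖ 1) := by
  have hU1 := self_mul_conjTranspose_of_mem hU
  have hinj : ∀ A B : QubitOp, A ⊗ₖ (1 : QubitOp) = B ⊗ₖ (1 : QubitOp) → A = B := by
    intro A B h
    ext i j
    simpa using congrFun (congrFun h (i, 0)) (j, 0)
  obtain ⟨T, hT, hT'⟩ := QubitOp.exists_conj_pauli_two (Z := Z) (by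
      apply hinj
      have : (Z ⊗ₖ (1 : QubitOp))ᴴ = Z ⊗ₖ 1 := by
        rw [← hZ, conjTranspose_mul, conjTranspose_mul, conjTranspose_conjTranspose, hP.eq,
          Matrix.mul_assoc]
      rwa [conjTranspose_kronecker, conjTranspose_one] at this) (by
      apply hinj
      rw [← Matrix.mul_one (1 : QubitOp), mul_kronecker_mul, Matrix.mul_one, one_kronecker_one,
        ← hZ]
      calc Uᴴ * P * U * (Uᴴ * P * U) = Uᴴ * (P * (U * Uᴴ) * P) * U := by
            simp only [Matrix.mul_assoc]
        _ = 1 := by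
          rw [hU1, Matrix.mul_one, hP2, Matrix.mul_one, conjTranspose_mul_self_of_mem hU]) (by
      have : (Z ⊗ₖ (1 : QubitOp)).trace = 0 := by
        rw [← hZ, Matrix.trace_mul_comm, ← Matrix.mul_assoc, hU1, Matrix.one_mul, hPtr]
      rw [trace_kronecker] at this
      simpa using this)
  refine ⟨T, hT, ?_⟩
  have h1 : P * U = U * (Z ⊗ₖ 1) := by
    rw [← hZ, ← Matrix.mul_assoc, ← Matrix.mul_assoc, hU1, Matrix.one_mul]
  rw [← Matrix.mul_assoc, h1, Matrix.mul_assoc, Matrix.mul_assoc, ← mul_kronecker_mul,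
    ← mul_kronecker_mul, hT', Matrix.mul_assoc, Matrix.mul_assoc,
    conjTranspose_mul_self_of_mem hT, Matrix.mul_one, Matrix.mul_one]

/-- A unitary under which every system observable evolves backwards to a system observable
is factorized. -/
lemma isFactorized_of_forall_intertwine {U : TwoQubitOp}
    (hU : U ∈ unitaryGroup (Fin 2 × Fin 2) ℂ)
    (h : ∀ A : QubitOp, ∃ B : QubitOp, Uᴴ * (A ⊗ₖ 1) * U = B ⊗ₖ 1) : IsFactorized U := by
  obtain ⟨Z, hZ⟩ := h (pauli 2)
  obtain ⟨T, hT, hc⟩ := exists_conj_pauli_two_of_intertwine hU (P := pauli 2 ⊗ₖ 1)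
    (by rw [Matrix.IsHermitian, conjTranspose_kronecker, pauli_conjTranspose, conjTranspose_one])
    (by rw [← mul_kronecker_mul, pauli_mul_self, Matrix.mul_one, one_kronecker_one])
    (by rw [trace_kronecker]; simp [pauli]) hZ
  have hT1 := self_mul_conjTranspose_of_mem hT
  have hS := swapGate_mem_unitaryGroup
  have hS2 := swapGate_mul_self
  set U' := U * (T ⊗ₖ (1 : QubitOp)) with hU'
  have hU'u : U' ∈ unitaryGroup (Fin 2 × Fin 2) ℂ :=
    mul_mem hU (kronecker_mem_unitary hT (one_mem _))
  obtain ⟨A, hA, hG⟩ := exists_eq_blockDiagonal (G := swapGate * U' * swapGate)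
    (mul_mem (mul_mem hS hU'u) hS) (by
      calc ((1 : QubitOp) ⊗ₖ pauli 2) * (swapGate * U' * swapGate)
          = ((1 : QubitOp) ⊗ₖ pauli 2) * swapGate * U' * swapGate := by
            simp only [Matrix.mul_assoc]
        _ = swapGate * ((pauli 2 ⊗ₖ (1 : QubitOp)) * U') * swapGate := by
            rw [← swapGate_mul_kronecker, Matrix.mul_assoc swapGate]
        _ = swapGate * U' * ((pauli 2 ⊗ₖ (1 : QubitOp)) * swapGate) := by
            rw [hc]; simp only [Matrix.mul_assoc]
        _ = _ := by rw [← swapGate_mul_kronecker]; simp only [Matrix.mul_assoc])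
  obtain ⟨B, hB⟩ := h (pauli 0)
  have hx : (blockDiagonal A)ᴴ * ((1 : QubitOp) ⊗ₖ pauli 0) * blockDiagonal A =
      (1 : QubitOp) ⊗ₖ (Tᴴ * B * T) := by
    calc (blockDiagonal A)ᴴ * ((1 : QubitOp) ⊗ₖ pauli 0) * blockDiagonal A
        = swapGate * U'ᴴ * (swapGate * ((1 : QubitOp) ⊗ₖ pauli 0) * swapGate) * U' * swapGate := by
          rw [← hG, conjTranspose_mul, conjTranspose_mul, swapGate_conjTranspose]
          simp only [Matrix.mul_assoc]
      _ = swapGate * ((T ⊗ₖ (1 : QubitOp))ᴴ * (Uᴴ * (pauli 0 ⊗ₖ 1) * U) * (T ⊗ₖ (1 : QubitOp))) *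
            swapGate := by
          rw [swapGate_mul_kronecker, Matrix.mul_assoc (_ ⊗ₖ _), hS2, Matrix.mul_one, hU',
            conjTranspose_mul]
          simp only [Matrix.mul_assoc]
      _ = _ := by
          rw [hB, conjTranspose_kronecker, conjTranspose_one, ← mul_kronecker_mul,
            ← mul_kronecker_mul, swapGate_mul_kronecker, Matrix.mul_assoc, hS2, Matrix.mul_one,
            Matrix.mul_one, Matrix.mul_one]
  -- The off-diagonal block says that the two controlled operations differ by a phase.
  obtain ⟨z, hz⟩ : ∃ z : ℂ, (A 0)ᴴ * A 1 = z • 1 := by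
    refine ⟨(Tᴴ * B * T) 0 1, ?_⟩
    ext i j
    have := congrFun (congrFun hx (i, 0)) (j, 1)
    simp only [Matrix.mul_apply, Fintype.sum_prod_type, Fin.sum_univ_two, blockDiagonal_apply,
      kroneckerMap_apply, conjTranspose_apply] at this
    fin_cases i <;> fin_cases j <;>
      simpa [pauli, Matrix.mul_apply, Fin.sum_univ_two] using this
  have hA1 : A 1 = z • A 0 := by
    rw [← Matrix.one_mul (A 1), ← self_mul_conjTranspose_of_mem (hA 0), Matrix.mul_assoc, hz,
      Matrix.mul_smul, Matrix.mul_one]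
  have hzu : star z * z = 1 := by
    have h1 := conjTranspose_mul_self_of_mem
      (mul_mem (conjTranspose_mem_unitaryGroup (hA 0)) (hA 1))
    rw [hz] at h1
    simpa [mul_comm] using congrFun (congrFun h1 0) 0
  have hD : (diagonal ![1, z] : QubitOp) ∈ unitaryGroup (Fin 2) ℂ := by
    rw [diagonal_mem_unitaryGroup]
    intro i; fin_cases i
    · simp
    · exact hzu
  have hbd : blockDiagonal A = A 0 ⊗ₖ diagonal ![1, z] := by
    ext ⟨i, a⟩ ⟨j, b⟩
    rw [blockDiagonal_apply]
    fin_cases a <;> fin_cases b <;> simp [hA1, mul_comm]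
  refine ⟨diagonal ![1, z] * Tᴴ, mul_mem hD (conjTranspose_mem_unitaryGroup hT), A 0, hA 0, ?_⟩
  calc U = swapGate * (swapGate * U' * swapGate) * swapGate * (T ⊗ₖ (1 : QubitOp))ᴴ := by
        rw [hU', conjTranspose_kronecker, conjTranspose_one]
        calc U = swapGate * swapGate * U * ((T ⊗ₖ 1) * (swapGate * swapGate * (Tᴴ ⊗ₖ 1))) := by
              rw [hS2, Matrix.one_mul, Matrix.one_mul, ← mul_kronecker_mul, hT1, Matrix.one_mul,
                one_kronecker_one, Matrix.mul_one]
          _ = _ := by simp only [Matrix.mul_assoc]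
    _ = _ := by
        rw [hG, hbd, swapGate_mul_kronecker, Matrix.mul_assoc (_ ⊗ₖ _), hS2, Matrix.mul_one,
          conjTranspose_kronecker, conjTranspose_one, ← mul_kronecker_mul, Matrix.mul_one]

/-- The exchange of the qubits composed with the controlled phase `diag (1, c, c, 1)`. -/
def phaseSwap (c : ℂ) : TwoQubitOp :=
  Matrix.of fun p q => if p.1 = q.2 ∧ p.2 = q.1 then (if p.1 = p.2 then 1 else c) else 0

/-- A unitary under which some memory observable that is not a scalar evolves backwards to a
system observable is, up to local unitaries, the swap followed by a controlled phase. -/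
lemma exists_phaseSwap_form {U : TwoQubitOp} (hU : U ∈ unitaryGroup (Fin 2 × Fin 2) ℂ)
    {Y Z : QubitOp} (hY : ¬ ∃ c : ℂ, Y = c • 1)
    (h : Uᴴ * ((1 : QubitOp) ⊗ₖ Y) * U = Z ⊗ₖ 1) :
    ∃ V₁ ∈ unitaryGroup (Fin 2) ℂ, ∃ W₁ ∈ unitaryGroup (Fin 2) ℂ,
    ∃ V₂ ∈ unitaryGroup (Fin 2) ℂ, ∃ W₂ ∈ unitaryGroup (Fin 2) ℂ, ∃ c : ℂ, star c * c = 1 ∧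
      U = (V₁ ⊗ₖ W₁) * phaseSwap c * (V₂ ⊗ₖ W₂) := by
  -- The observable may be taken to be Hermitian.
  obtain ⟨H, K, hH, hHs, hHK⟩ : ∃ H K : QubitOp, H.IsHermitian ∧ (¬ ∃ c : ℂ, H = c • 1) ∧
      Uᴴ * ((1 : QubitOp) ⊗ₖ H) * U = K ⊗ₖ 1 := by
    have h' : Uᴴ * ((1 : QubitOp) ⊗ₖ Yᴴ) * U = Zᴴ ⊗ₖ 1 := by
      have := congrArg conjTranspose h
      rw [conjTranspose_mul, conjTranspose_mul, conjTranspose_conjTranspose,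
        conjTranspose_kronecker, conjTranspose_kronecker, conjTranspose_one] at this
      rw [Matrix.mul_assoc, this]
    by_cases h1 : ∃ c : ℂ, Y + Yᴴ = c • 1
    · refine ⟨I • (Y - Yᴴ), I • (Z - Zᴴ), ?_, ?_, ?_⟩
      · rw [Matrix.IsHermitian, conjTranspose_smul, conjTranspose_sub, conjTranspose_conjTranspose,
          star_def, conj_I]
        module
      · rintro ⟨b, hb⟩
        obtain ⟨a, ha⟩ := h1
        refine hY ⟨(a - I * b) / 2, ?_⟩
        have h3 : Y = (1 / 2 : ℂ) • ((Y + Yᴴ) - I • (I • (Y - Yᴴ))) := by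
          rw [smul_smul, I_mul_I, neg_one_smul]; module
        rw [h3, ha, hb]; module
      · have e1 : (1 : QubitOp) ⊗ₖ (I • (Y - Yᴴ)) =
            I • ((1 : QubitOp) ⊗ₖ Y) - I • ((1 : QubitOp) ⊗ₖ Yᴴ) := by
          rw [kronecker_smul, QubitOp.kronecker_sub, smul_sub]
        have e2 : (I • (Z - Zᴴ)) ⊗ₖ (1 : QubitOp) =
            I • (Z ⊗ₖ (1 : QubitOp)) - I • (Zᴴ ⊗ₖ (1 : QubitOp)) := by
          rw [smul_kronecker, QubitOp.sub_kronecker, smul_sub]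
        rw [e1, e2, Matrix.mul_sub, Matrix.sub_mul, Matrix.mul_smul, Matrix.mul_smul,
          Matrix.smul_mul, Matrix.smul_mul, h, h']
    · refine ⟨Y + Yᴴ, Z + Zᴴ, ?_, h1, ?_⟩
      · rw [Matrix.IsHermitian, conjTranspose_add, conjTranspose_conjTranspose, add_comm]
      · rw [kronecker_add, add_kronecker, Matrix.mul_add, Matrix.add_mul, h, h']
  obtain ⟨V, hV, d, hd⟩ := isHermitian_exists_conj_diagonal hH
  have hV1 := conjTranspose_mul_self_of_mem hV
  have hV2 := self_mul_conjTranspose_of_mem hV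
  have hd01 : d 0 - d 1 ≠ 0 := fun h => hHs ⟨d 0, by
    rw [hd, QubitOp.diagonal_scalar (sub_eq_zero.1 h), Matrix.mul_smul, Matrix.mul_one,
      Matrix.smul_mul, hV2]⟩
  -- Shifted and rescaled, it becomes `σ_z` in its eigenbasis.
  have hσ : V * pauli 2 * Vᴴ = (2 / (d 0 - d 1)) • H - ((d 0 + d 1) / (d 0 - d 1)) • 1 := by
    have : pauli 2 = (2 / (d 0 - d 1)) • diagonal d - ((d 0 + d 1) / (d 0 - d 1)) • 1 := by
      ext i j
      fin_cases i <;> fin_cases j <;> simp [pauli] <;> field_simp <;> ring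
    rw [this, hd, Matrix.mul_sub, Matrix.sub_mul, Matrix.mul_smul, Matrix.mul_smul,
      Matrix.smul_mul, Matrix.smul_mul, Matrix.mul_one, hV2]
  have hU1 := conjTranspose_mul_self_of_mem hU
  obtain ⟨T, hT, hc⟩ := exists_conj_pauli_two_of_intertwine hU
    (P := (1 : QubitOp) ⊗ₖ (V * pauli 2 * Vᴴ))
    (Z := (2 / (d 0 - d 1)) • K - ((d 0 + d 1) / (d 0 - d 1)) • 1)
    (by rw [Matrix.IsHermitian, conjTranspose_kronecker, conjTranspose_mul, conjTranspose_mul,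
          pauli_conjTranspose, conjTranspose_conjTranspose, conjTranspose_one, Matrix.mul_assoc])
    (by
      rw [← mul_kronecker_mul, Matrix.mul_one]
      have : V * pauli 2 * Vᴴ * (V * pauli 2 * Vᴴ) = 1 := by
        calc _ = V * (pauli 2 * (Vᴴ * V) * pauli 2) * Vᴴ := by simp only [Matrix.mul_assoc]
          _ = 1 := by rw [hV1, Matrix.mul_one, pauli_mul_self, Matrix.mul_one, hV2]
      rw [this, one_kronecker_one])
    (by
      rw [trace_kronecker, Matrix.trace_mul_comm, ← Matrix.mul_assoc, hV1, Matrix.one_mul]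
      simp [pauli])
    (by
      have e1 : (1 : QubitOp) ⊗ₖ (V * pauli 2 * Vᴴ) = (2 / (d 0 - d 1)) • ((1 : QubitOp) ⊗ₖ H) -
          ((d 0 + d 1) / (d 0 - d 1)) • 1 := by
        rw [hσ, QubitOp.kronecker_sub, kronecker_smul, kronecker_smul, one_kronecker_one]
      rw [e1, Matrix.mul_sub, Matrix.sub_mul, Matrix.mul_smul, Matrix.smul_mul, hHK,
        Matrix.mul_smul, Matrix.smul_mul, Matrix.mul_one, hU1, QubitOp.sub_kronecker,
        smul_kronecker, smul_kronecker, one_kronecker_one])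
  have hS := swapGate_mem_unitaryGroup
  have hS2 := swapGate_mul_self
  set U' := ((1 : QubitOp) ⊗ₖ Vᴴ) * (U * (T ⊗ₖ (1 : QubitOp))) with hU'
  have hU'u : U' ∈ unitaryGroup (Fin 2 × Fin 2) ℂ :=
    mul_mem (kronecker_mem_unitary (one_mem _) (conjTranspose_mem_unitaryGroup hV))
      (mul_mem hU (kronecker_mem_unitary hT (one_mem _)))
  have hc' : ((1 : QubitOp) ⊗ₖ pauli 2) * U' = U' * (pauli 2 ⊗ₖ (1 : QubitOp)) := by
    have e : ((1 : QubitOp) ⊗ₖ pauli 2) * ((1 : QubitOp) ⊗ₖ Vᴴ) =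
        ((1 : QubitOp) ⊗ₖ Vᴴ) * ((1 : QubitOp) ⊗ₖ (V * pauli 2 * Vᴴ)) := by
      rw [← mul_kronecker_mul, ← mul_kronecker_mul, ← Matrix.mul_assoc, ← Matrix.mul_assoc, hV1,
        Matrix.one_mul, Matrix.one_mul]
    rw [hU', ← Matrix.mul_assoc, e, Matrix.mul_assoc, hc]
    simp only [Matrix.mul_assoc]
  obtain ⟨A, hA, hG⟩ := exists_eq_blockDiagonal (G := U' * swapGate) (mul_mem hU'u hS) (by
    rw [← Matrix.mul_assoc, hc', Matrix.mul_assoc U', Matrix.mul_assoc U', swapGate_mul_kronecker])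
  obtain ⟨R, hR, u, hu, hBu⟩ := QubitOp.unitary_exists_conj_diagonal
    (mul_mem (conjTranspose_mem_unitaryGroup (hA 0)) (hA 1))
  have hR2 := self_mul_conjTranspose_of_mem hR
  -- The phase `c` is determined up to a sign by `c ^ 2 = u 0 / u 1`.
  obtain ⟨c, hc2⟩ : ∃ c : ℂ, c ^ 2 = u 0 * star (u 1) := by
    obtain ⟨c, hc⟩ := IsAlgClosed.exists_pow_nat_eq (u 0 * star (u 1)) (n := 2) two_pos
    exact ⟨c, hc⟩
  have hnorm : ∀ z : ℂ, star z * z = 1 ↔ ‖z‖ = 1 := fun z => by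
    rw [star_def, conj_mul']
    norm_cast
    exact pow_eq_one_iff_of_nonneg (norm_nonneg z) two_ne_zero
  have hcu : star c * c = 1 := by
    rw [hnorm]
    refine (pow_eq_one_iff_of_nonneg (norm_nonneg c) two_ne_zero).1 ?_
    rw [← norm_pow, hc2, norm_mul, norm_star, (hnorm _).1 (hu 0), (hnorm _).1 (hu 1), one_mul]
  have hD2 : (diagonal ![1, star c] : QubitOp) ∈ unitaryGroup (Fin 2) ℂ := by
    rw [diagonal_mem_unitaryGroup]
    intro i; fin_cases i
    · simp
    · simpa [mul_comm] using hcu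
  have hD1 : (diagonal ![1, u 0 * star c] : QubitOp) ∈ unitaryGroup (Fin 2) ℂ := by
    rw [diagonal_mem_unitaryGroup]
    intro i; fin_cases i
    · simp
    · have := hu 0
      simp at this hcu ⊢
      linear_combination hcu * (starRingEnd ℂ) (u 0) * u 0 + this
  have hA1 : A 1 = A 0 * R * diagonal u * Rᴴ := by
    rw [← Matrix.one_mul (A 1), ← self_mul_conjTranspose_of_mem (hA 0), Matrix.mul_assoc, hBu]
    simp only [Matrix.mul_assoc]
  have hA0 : A 0 = A 0 * R * 1 * Rᴴ := by
    rw [Matrix.mul_one, Matrix.mul_assoc, hR2, Matrix.mul_one]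
  have hbd : blockDiagonal A = ((A 0 * R) ⊗ₖ (1 : QubitOp)) *
      (((diagonal ![1, star c]) ⊗ₖ (diagonal ![1, u 0 * star c])) *
        (phaseSwap c * swapGate)) * (Rᴴ ⊗ₖ (1 : QubitOp)) := by
    have e1 : ∀ B : QubitOp, B ⊗ₖ (1 : QubitOp) = blockDiagonal fun _ => B := fun B => by
      ext ⟨i, a⟩ ⟨j, b⟩
      rw [blockDiagonal_apply]
      simp [Matrix.one_apply]
    have e2 : ((diagonal ![1, star c]) ⊗ₖ (diagonal ![1, u 0 * star c])) *
        (phaseSwap c * swapGate) = blockDiagonal ![1, diagonal u] := by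
      have hc3 : u 0 * (starRingEnd ℂ) c * (starRingEnd ℂ) c = u 1 := by
        have h4 : (starRingEnd ℂ) c ^ 2 = star (u 0) * u 1 := by
          rw [← map_pow, hc2]; simp
        have := hu 0
        linear_combination u 0 * h4 + this * u 1
      simp at hcu
      rw [diagonal_kronecker_diagonal]
      ext ⟨i, a⟩ ⟨j, b⟩
      rw [diagonal_mul, blockDiagonal_apply]
      simp only [phaseSwap, swapGate, Matrix.mul_apply, Fintype.sum_prod_type, Fin.sum_univ_two,
        Matrix.of_apply]
      fin_cases i <;> fin_cases a <;> fin_cases j <;> fin_cases b <;> simp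
      · linear_combination u 0 * hcu
      · exact hcu
      · linear_combination hc3
    rw [e1, e1, e2, ← blockDiagonal_mul, ← blockDiagonal_mul]
    congr 1
    ext k : 1
    fin_cases k
    · exact hA0
    · exact hA1
  refine ⟨A 0 * R * diagonal ![1, star c], mul_mem (mul_mem (hA 0) hR) hD2,
    V * diagonal ![1, u 0 * star c], mul_mem hV hD1, Tᴴ, conjTranspose_mem_unitaryGroup hT,
    Rᴴ, conjTranspose_mem_unitaryGroup hR, c, hcu, ?_⟩
  calc U = ((1 : QubitOp) ⊗ₖ V) * (U' * swapGate) * swapGate * (Tᴴ ⊗ₖ (1 : QubitOp)) := by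
        rw [hU']
        calc U = (((1 : QubitOp) ⊗ₖ V) * ((1 : QubitOp) ⊗ₖ Vᴴ)) * U *
              ((T ⊗ₖ (1 : QubitOp)) * ((swapGate * swapGate) * (Tᴴ ⊗ₖ (1 : QubitOp)))) := by
              rw [hS2, Matrix.one_mul, ← mul_kronecker_mul, ← mul_kronecker_mul, hV2,
                self_mul_conjTranspose_of_mem hT, Matrix.one_mul, one_kronecker_one,
                Matrix.one_mul, Matrix.mul_one]
          _ = _ := by simp only [Matrix.mul_assoc]
    _ = ((1 : QubitOp) ⊗ₖ V) * ((A 0 * R) ⊗ₖ (1 : QubitOp)) *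
          ((diagonal ![1, star c]) ⊗ₖ (diagonal ![1, u 0 * star c])) *
          phaseSwap c * (swapGate * ((Rᴴ ⊗ₖ (1 : QubitOp)) * swapGate)) *
          (Tᴴ ⊗ₖ (1 : QubitOp)) := by
        rw [hG, hbd]
        simp only [Matrix.mul_assoc]
    _ = _ := by
        rw [← swapGate_mul_kronecker, ← Matrix.mul_assoc swapGate, hS2, Matrix.one_mul,
          Matrix.mul_assoc _ _ (Tᴴ ⊗ₖ _), ← mul_kronecker_mul, ← mul_kronecker_mul,
          ← mul_kronecker_mul]
        simp only [Matrix.one_mul, Matrix.mul_one]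

/-- Finite memory depth leaves only two possibilities: no interaction at all, or a swap with a
controlled phase. -/
lemma ForgetsAfter.isFactorized_or_phaseSwap {U : TwoQubitOp}
    (hU : U ∈ unitaryGroup (Fin 2 × Fin 2) ℂ) {Δ : ℕ} (h : ForgetsAfter U Δ) :
    IsFactorized U ∨ ∃ V₁ ∈ unitaryGroup (Fin 2) ℂ, ∃ W₁ ∈ unitaryGroup (Fin 2) ℂ,
      ∃ V₂ ∈ unitaryGroup (Fin 2) ℂ, ∃ W₂ ∈ unitaryGroup (Fin 2) ℂ, ∃ c : ℂ, star c * c = 1 ∧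
        U = (V₁ ⊗ₖ W₁) * phaseSwap c * (V₂ ⊗ₖ W₂) := by
  have h0 : ∀ Y, IsBlind U 0 Y → ∃ c : ℂ, Y = c • 1 := fun Y hY =>
    scalar_of_trace_mul_const fun ξ ξ' hξ hξ' =>
      hY (fun _ => Matrix.single 0 0 1) ξ ξ' (fun _ => isState_single 0) hξ hξ'
  by_cases hall : ∀ A σ : QubitOp, IsState σ →
      ∃ c : ℂ, effectiveObs σ (Uᴴ * (A ⊗ₖ (1 : QubitOp)) * U) = c • 1
  · exact Or.inl <| isFactorized_of_forall_intertwine hU fun A => exists_eq_kronecker_one (hall A)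
  · push Not at hall
    obtain ⟨A, σ, -, hns⟩ := hall
    obtain ⟨Y, hY, hY'⟩ := (h.isBlind A σ).exists_effectiveObs_scalar h0 fun ⟨c, hc⟩ => hns c hc
    obtain ⟨Z, hZ⟩ := exists_eq_kronecker_one hY'
    exact Or.inr (exists_phaseSwap_form hU hY hZ)

end Classification

/-! ### Local unitaries and sufficient conditions for forgetting -/

section LocalUnitaries

variable {S M : Type*} [Fintype S] [Fintype M]

lemma kronecker_conj_kronecker (V₁ V₂ ρ : Matrix S S ℂ) (W₁ W₂ ξ : Matrix M M ℂ)
    (G : Matrix (S × M) (S × M) ℂ) :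
    (V₁ ⊗ₖ W₁) * G * (V₂ ⊗ₖ W₂) * (ρ ⊗ₖ ξ) * ((V₁ ⊗ₖ W₁) * G * (V₂ ⊗ₖ W₂))ᴴ =
      (V₁ ⊗ₖ W₁) * (G * ((V₂ * ρ * V₂ᴴ) ⊗ₖ (W₂ * ξ * W₂ᴴ)) * Gᴴ) * (V₁ ⊗ₖ W₁)ᴴ := by
  rw [conjTranspose_mul, conjTranspose_mul, mul_kronecker_mul, mul_kronecker_mul,
    conjTranspose_kronecker V₂]
  simp only [Matrix.mul_assoc]

lemma IsState.conj [DecidableEq S] {ρ : Matrix S S ℂ} (hρ : IsState ρ) {V : Matrix S S ℂ}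
    (hV : V ∈ unitaryGroup S ℂ) : IsState (Vᴴ * ρ * V) := by
  refine ⟨hρ.1.conjTranspose_mul_mul_same V, ?_⟩
  rw [Matrix.trace_mul_comm, ← Matrix.mul_assoc, self_mul_conjTranspose_of_mem hV, Matrix.one_mul,
    hρ.2]

lemma systemChannel_local [DecidableEq M] (V₁ V₂ : Matrix S S ℂ) {W₁ : Matrix M M ℂ}
    (hW₁ : W₁ ∈ unitaryGroup M ℂ) (W₂ : Matrix M M ℂ) (G : Matrix (S × M) (S × M) ℂ)
    (ξ : Matrix M M ℂ) (ρ : Matrix S S ℂ) :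
    systemChannel ((V₁ ⊗ₖ W₁) * G * (V₂ ⊗ₖ W₂)) ξ ρ =
      V₁ * systemChannel G (W₂ * ξ * W₂ᴴ) (V₂ * ρ * V₂ᴴ) * V₁ᴴ := by
  have := traceMem_kronecker_conj V₁ hW₁ (G * ((V₂ * ρ * V₂ᴴ) ⊗ₖ (W₂ * ξ * W₂ᴴ)) * Gᴴ)
  rw [← kronecker_conj_kronecker] at this
  exact this

lemma concurrentChannel_local [DecidableEq S] {V₁ : Matrix S S ℂ} (hV₁ : V₁ ∈ unitaryGroup S ℂ)
    (V₂ : Matrix S S ℂ) (W₁ W₂ : Matrix M M ℂ) (G : Matrix (S × M) (S × M) ℂ)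
    (ξ : Matrix M M ℂ) (ρ : Matrix S S ℂ) :
    concurrentChannel ((V₁ ⊗ₖ W₁) * G * (V₂ ⊗ₖ W₂)) ρ ξ =
      W₁ * concurrentChannel G (V₂ * ρ * V₂ᴴ) (W₂ * ξ * W₂ᴴ) * W₁ᴴ := by
  have := traceSys_kronecker_conj hV₁ W₁ (G * ((V₂ * ρ * V₂ᴴ) ⊗ₖ (W₂ * ξ * W₂ᴴ)) * Gᴴ)
  rw [← kronecker_conj_kronecker] at this
  exact this

lemma trace_conj [DecidableEq M] {W : Matrix M M ℂ} (hW : W ∈ unitaryGroup M ℂ) (X : Matrix M M ℂ) :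
    (W * X * Wᴴ).trace = X.trace := by
  rw [Matrix.trace_mul_comm, ← Matrix.mul_assoc, conjTranspose_mul_self_of_mem hW, Matrix.one_mul]

variable [DecidableEq S] [DecidableEq M]

lemma trace_memoryState_sub {U : Matrix (S × M) (S × M) ℂ} (hU : U ∈ unitaryGroup (S × M) ℂ)
    {ρ ρ' : ℕ → Matrix S S ℂ} (hρ : ∀ j, IsState (ρ j)) (hρ' : ∀ j, IsState (ρ' j))
    {ξ ξ' : Matrix M M ℂ} (hξ : IsState ξ) (hξ' : IsState ξ') (n : ℕ) :
    (memoryState U ρ ξ n - memoryState U ρ' ξ' n).trace = 0 := by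
  rw [Matrix.trace_sub, trace_memoryState hU hρ, trace_memoryState hU hρ', hξ.2, hξ'.2, sub_self]

lemma forgetsAfter_one {U : Matrix (S × M) (S × M) ℂ} (hU : U ∈ unitaryGroup (S × M) ℂ)
    (h : ∀ (ρ : Matrix S S ℂ) (X : Matrix M M ℂ), X.trace = 0 → concurrentChannel U ρ X = 0) :
    ForgetsAfter U 1 := by
  rintro (_ | n) hn ρ ρ' ξ ξ' hρ hρ' hξ hξ' hj
  · omega
  have h1 := hj n (by omega) (by omega)
  have := h (ρ n) _ (trace_memoryState_sub hU hρ hρ' hξ hξ' n)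
  rw [map_sub, sub_eq_zero, h1] at this
  simp only [runChannel, memoryState, h1, this]

lemma forgetsAfter_two {U : Matrix (S × M) (S × M) ℂ} (hU : U ∈ unitaryGroup (S × M) ℂ)
    (h : ∀ (ρ σ : Matrix S S ℂ) (X : Matrix M M ℂ), IsState σ → X.trace = 0 →
      concurrentChannel U ρ (concurrentChannel U σ X) = 0) :
    ForgetsAfter U 2 := by
  rintro (_ | _ | n) hn ρ ρ' ξ ξ' hρ hρ' hξ hξ' hj
  · omega
  · omega
  have h1 := hj n (by omega) (by omega)
  have h2 := hj (n + 1) (by omega) (by omega)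
  have := h (ρ (n + 1)) (ρ n) _ (hρ n) (trace_memoryState_sub hU hρ hρ' hξ hξ' n)
  rw [map_sub, map_sub, sub_eq_zero, h1, h2] at this
  simp only [runChannel, memoryState, h1, h2, this]

end LocalUnitaries

/-! ### Memory of a swap with a controlled phase -/

section PhaseSwap

lemma phaseSwap_mem_unitaryGroup {c : ℂ} (hc : star c * c = 1) :
    phaseSwap c ∈ unitaryGroup (Fin 2 × Fin 2) ℂ := by
  rw [mem_unitaryGroup_iff']
  ext ⟨i, a⟩ ⟨j, b⟩
  simp only [phaseSwap, star_eq_conjTranspose, conjTranspose_apply, Matrix.mul_apply,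
    Fintype.sum_prod_type, Fin.sum_univ_two, Matrix.of_apply]
  fin_cases i <;> fin_cases a <;> fin_cases j <;> fin_cases b <;> simp <;> exact hc

lemma systemChannel_phaseSwap_single {c : ℂ} (hc : star c * c = 1) (X : QubitOp) :
    systemChannel (phaseSwap c) X (Matrix.single 0 0 1) =
      !![X 0 0, star c * X 0 1; c * X 1 0, X 1 1] := by
  simp at hc
  ext i j
  simp only [systemChannel, traceMem, LinearMap.coe_mk, AddHom.coe_mk, Matrix.of_apply,
    Matrix.mul_apply, Fintype.sum_prod_type, Fin.sum_univ_two, phaseSwap, conjTranspose_apply,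
    kroneckerMap_apply]
  fin_cases i <;> fin_cases j <;> simp
  · ring
  · linear_combination X 1 1 * hc

/-- The swap with controlled phase `c` writes the off-diagonal part of the input into the memory,
weighted by the `σ_z`-component of the old memory and by `c̄ - c`. -/
lemma concurrentChannel_phaseSwap {c : ℂ} (hc : star c * c = 1) (ρ : QubitOp) {X : QubitOp}
    (hX : X.trace = 0) :
    concurrentChannel (phaseSwap c) ρ X = (X 0 0 * (star c - c)) • !![0, ρ 0 1; -ρ 1 0, 0] := by
  simp at hc
  rw [Matrix.trace_fin_two] at hX
  ext i j
  simp only [concurrentChannel, traceSys, LinearMap.coe_mk, AddHom.coe_mk, Matrix.of_apply,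
    Matrix.mul_apply, Fintype.sum_prod_type, Fin.sum_univ_two, phaseSwap, conjTranspose_apply,
    kroneckerMap_apply]
  fin_cases i <;> fin_cases j <;> simp
  · linear_combination ρ 0 0 * X 1 1 * hc + ρ 0 0 * hX
  · linear_combination ρ 0 1 * c * hX
  · linear_combination ρ 1 0 * (starRingEnd ℂ) c * hX
  · linear_combination ρ 1 1 * X 0 0 * hc + ρ 1 1 * hX

lemma QubitOp.conj_offDiag_apply_zero_zero (W : QubitOp) (r s : ℂ) :
    (W * !![0, r; -s, 0] * Wᴴ) 0 0 = W 0 0 * star (W 0 1) * r - star (W 0 0) * W 0 1 * s := by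
  simp [Matrix.mul_apply, Fin.sum_univ_two]
  ring

variable {V₁ V₂ W₁ W₂ : QubitOp} {c : ℂ}

lemma phaseSwapForm_mem_unitaryGroup (hV₁ : V₁ ∈ unitaryGroup (Fin 2) ℂ)
    (hW₁ : W₁ ∈ unitaryGroup (Fin 2) ℂ) (hV₂ : V₂ ∈ unitaryGroup (Fin 2) ℂ)
    (hW₂ : W₂ ∈ unitaryGroup (Fin 2) ℂ) (hc : star c * c = 1) :
    (V₁ ⊗ₖ W₁) * phaseSwap c * (V₂ ⊗ₖ W₂) ∈ unitaryGroup (Fin 2 × Fin 2) ℂ :=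
  mul_mem (mul_mem (kronecker_mem_unitary hV₁ hW₁) (phaseSwap_mem_unitaryGroup hc))
    (kronecker_mem_unitary hV₂ hW₂)

lemma concurrentChannel_phaseSwapForm (hV₁ : V₁ ∈ unitaryGroup (Fin 2) ℂ)
    (hW₂ : W₂ ∈ unitaryGroup (Fin 2) ℂ) (hc : star c * c = 1) (ρ : QubitOp) {X : QubitOp}
    (hX : X.trace = 0) :
    concurrentChannel ((V₁ ⊗ₖ W₁) * phaseSwap c * (V₂ ⊗ₖ W₂)) ρ X =
      ((W₂ * X * W₂ᴴ) 0 0 * (star c - c)) •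
        (W₁ * !![0, (V₂ * ρ * V₂ᴴ) 0 1; -(V₂ * ρ * V₂ᴴ) 1 0, 0] * W₁ᴴ) := by
  rw [concurrentChannel_local hV₁, concurrentChannel_phaseSwap hc _ (by rw [trace_conj hW₂, hX]),
    Matrix.mul_smul, Matrix.smul_mul]

/-- One run multiplies the component of the memory that the next run can pass on, the
`σ_z`-component in the frame of `W₂`, by a factor that vanishes for every input when `W₂ W₁` is
diagonal or antidiagonal. -/
lemma concurrentChannel_phaseSwapForm_apply_zero_zero (hV₁ : V₁ ∈ unitaryGroup (Fin 2) ℂ)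
    (hW₂ : W₂ ∈ unitaryGroup (Fin 2) ℂ) (hc : star c * c = 1) (ρ : QubitOp) {X : QubitOp}
    (hX : X.trace = 0) :
    (W₂ * concurrentChannel ((V₁ ⊗ₖ W₁) * phaseSwap c * (V₂ ⊗ₖ W₂)) ρ X * W₂ᴴ) 0 0 =
      (W₂ * X * W₂ᴴ) 0 0 * ((star c - c) *
        ((W₂ * W₁) 0 0 * star ((W₂ * W₁) 0 1) * (V₂ * ρ * V₂ᴴ) 0 1 -
          star ((W₂ * W₁) 0 0) * (W₂ * W₁) 0 1 * (V₂ * ρ * V₂ᴴ) 1 0)) := by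
  rw [← QubitOp.conj_offDiag_apply_zero_zero, concurrentChannel_phaseSwapForm hV₁ hW₂ hc ρ hX,
    Matrix.mul_smul, Matrix.smul_mul, Matrix.smul_apply, smul_eq_mul, conjTranspose_mul, mul_assoc]
  simp only [Matrix.mul_assoc]

/-- The action on the input reveals the full memory state. -/
lemma systemChannel_phaseSwapForm_injective (hV₁ : V₁ ∈ unitaryGroup (Fin 2) ℂ)
    (hW₁ : W₁ ∈ unitaryGroup (Fin 2) ℂ) (hV₂ : V₂ ∈ unitaryGroup (Fin 2) ℂ)
    (hW₂ : W₂ ∈ unitaryGroup (Fin 2) ℂ) (hc : star c * c = 1) :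
    Function.Injective (systemChannel ((V₁ ⊗ₖ W₁) * phaseSwap c * (V₂ ⊗ₖ W₂))) := by
  intro ξ ξ' h
  have h1 := LinearMap.congr_fun h (V₂ᴴ * Matrix.single 0 0 1 * V₂)
  have hV : V₂ * (V₂ᴴ * Matrix.single 0 0 1 * V₂) * V₂ᴴ = Matrix.single 0 0 1 := by
    calc _ = (V₂ * V₂ᴴ) * Matrix.single 0 0 1 * (V₂ * V₂ᴴ) := by simp only [Matrix.mul_assoc]
      _ = _ := by rw [self_mul_conjTranspose_of_mem hV₂, Matrix.one_mul, Matrix.mul_one]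
  rw [systemChannel_local _ _ hW₁, systemChannel_local _ _ hW₁, hV,
    systemChannel_phaseSwap_single hc, systemChannel_phaseSwap_single hc] at h1
  have h2 := mul_conjTranspose_cancel hV₁ h1
  have h3 := mul_conjTranspose_cancel hV₁ (rfl : V₁ * !![(W₂ * ξ * W₂ᴴ) 0 0,
    star c * (W₂ * ξ * W₂ᴴ) 0 1; c * (W₂ * ξ * W₂ᴴ) 1 0, (W₂ * ξ * W₂ᴴ) 1 1] * V₁ᴴ = _)
  rw [h3] at h2
  have hc0 : c ≠ 0 := by rintro rfl; simp at hc
  have h4 : W₂ * ξ * W₂ᴴ = W₂ * ξ' * W₂ᴴ := by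
    ext i j
    have := congrFun (congrFun h2 i) j
    fin_cases i <;> fin_cases j <;> simpa [hc0] using this
  exact (mul_conjTranspose_cancel hW₂ rfl).symm.trans (mul_conjTranspose_cancel hW₂ h4)

lemma memoryState_eq_of_forgetsAfter_phaseSwapForm (hV₁ : V₁ ∈ unitaryGroup (Fin 2) ℂ)
    (hW₁ : W₁ ∈ unitaryGroup (Fin 2) ℂ) (hV₂ : V₂ ∈ unitaryGroup (Fin 2) ℂ)
    (hW₂ : W₂ ∈ unitaryGroup (Fin 2) ℂ) (hc : star c * c = 1) {Δ : ℕ}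
    (h : ForgetsAfter ((V₁ ⊗ₖ W₁) * phaseSwap c * (V₂ ⊗ₖ W₂)) Δ) {ρ : QubitOp} (hρ : IsState ρ) :
    memoryState ((V₁ ⊗ₖ W₁) * phaseSwap c * (V₂ ⊗ₖ W₂)) (fun _ => ρ) (W₂ᴴ * pauli 2 * W₂) Δ
      = 0 := by
  have hz : W₂ᴴ * pauli 2 * W₂ =
      W₂ᴴ * Matrix.single 0 0 1 * W₂ - W₂ᴴ * Matrix.single 1 1 1 * W₂ := by
    rw [← Matrix.sub_mul, ← Matrix.mul_sub]
    congr 2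
    ext i j
    fin_cases i <;> fin_cases j <;> simp [pauli]
  rw [hz, ← memoryState_sub, sub_eq_zero]
  exact systemChannel_phaseSwapForm_injective hV₁ hW₁ hV₂ hW₂ hc <|
    h Δ le_rfl _ _ _ _ (fun _ => hρ) (fun _ => hρ) ((isState_single 0).conj hW₂)
      ((isState_single 1).conj hW₂) fun _ _ _ => rfl

lemma conj_conjTranspose_conj {W : QubitOp} (hW : W ∈ unitaryGroup (Fin 2) ℂ) (X : QubitOp) :
    W * (Wᴴ * X * W) * Wᴴ = X := by
  calc _ = (W * Wᴴ) * X * (W * Wᴴ) := by simp only [Matrix.mul_assoc]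
    _ = _ := by rw [self_mul_conjTranspose_of_mem hW, Matrix.one_mul, Matrix.mul_one]

lemma trace_conj_pauli_two (hW₂ : W₂ ∈ unitaryGroup (Fin 2) ℂ) :
    (W₂ᴴ * pauli 2 * W₂).trace = 0 := by
  rw [← trace_conj hW₂, conj_conjTranspose_conj hW₂]
  simp [pauli]

lemma not_forgetsAfter_zero_phaseSwapForm (hV₁ : V₁ ∈ unitaryGroup (Fin 2) ℂ)
    (hW₁ : W₁ ∈ unitaryGroup (Fin 2) ℂ) (hV₂ : V₂ ∈ unitaryGroup (Fin 2) ℂ)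
    (hW₂ : W₂ ∈ unitaryGroup (Fin 2) ℂ) (hc : star c * c = 1) :
    ¬ ForgetsAfter ((V₁ ⊗ₖ W₁) * phaseSwap c * (V₂ ⊗ₖ W₂)) 0 := fun h => by
  have := memoryState_eq_of_forgetsAfter_phaseSwapForm hV₁ hW₁ hV₂ hW₂ hc h (isState_single 0)
  rw [memoryState] at this
  have h1 := conj_conjTranspose_conj hW₂ (pauli 2)
  rw [this, Matrix.mul_zero, Matrix.zero_mul] at h1
  simpa [pauli] using congrFun (congrFun h1 0) 0

lemma star_sub_self_eq_zero_iff (hc : star c * c = 1) : star c - c = 0 ↔ c ^ 2 = 1 := by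
  have hc0 : c ≠ 0 := by rintro rfl; simp at hc
  rw [sub_eq_zero, ← mul_left_inj' hc0, hc, sq, eq_comm]

lemma forgetsAfter_one_phaseSwapForm (hV₁ : V₁ ∈ unitaryGroup (Fin 2) ℂ)
    (hW₁ : W₁ ∈ unitaryGroup (Fin 2) ℂ) (hV₂ : V₂ ∈ unitaryGroup (Fin 2) ℂ)
    (hW₂ : W₂ ∈ unitaryGroup (Fin 2) ℂ) (hc : star c * c = 1) (hc2 : c ^ 2 = 1) :
    ForgetsAfter ((V₁ ⊗ₖ W₁) * phaseSwap c * (V₂ ⊗ₖ W₂)) 1 := by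
  refine forgetsAfter_one (phaseSwapForm_mem_unitaryGroup hV₁ hW₁ hV₂ hW₂ hc) fun ρ X hX => ?_
  rw [concurrentChannel_phaseSwapForm hV₁ hW₂ hc ρ hX, (star_sub_self_eq_zero_iff hc).2 hc2,
    mul_zero, zero_smul]

lemma not_forgetsAfter_one_phaseSwapForm (hV₁ : V₁ ∈ unitaryGroup (Fin 2) ℂ)
    (hW₁ : W₁ ∈ unitaryGroup (Fin 2) ℂ) (hV₂ : V₂ ∈ unitaryGroup (Fin 2) ℂ)
    (hW₂ : W₂ ∈ unitaryGroup (Fin 2) ℂ) (hc : star c * c = 1) (hc2 : c ^ 2 ≠ 1) :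
    ¬ ForgetsAfter ((V₁ ⊗ₖ W₁) * phaseSwap c * (V₂ ⊗ₖ W₂)) 1 := fun h => by
  have := memoryState_eq_of_forgetsAfter_phaseSwapForm hV₁ hW₁ hV₂ hW₂ hc h
    ((isState_equatorState (r := 1) (by simp)).conj hV₂)
  rw [memoryState, memoryState, concurrentChannel_phaseSwapForm hV₁ hW₂ hc _
    (trace_conj_pauli_two hW₂), conj_conjTranspose_conj hW₂, conj_conjTranspose_conj hV₂,
    smul_eq_zero] at this
  rcases this with h0 | h0
  · have := (star_sub_self_eq_zero_iff hc).not.2 hc2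
    simp [pauli] at h0
    exact this h0
  · have := mul_conjTranspose_cancel hW₁ h0.symm
    rw [Matrix.mul_zero, Matrix.zero_mul] at this
    simpa [equatorState] using congrFun (congrFun this 0) 1

lemma forgetsAfter_two_phaseSwapForm (hV₁ : V₁ ∈ unitaryGroup (Fin 2) ℂ)
    (hW₁ : W₁ ∈ unitaryGroup (Fin 2) ℂ) (hV₂ : V₂ ∈ unitaryGroup (Fin 2) ℂ)
    (hW₂ : W₂ ∈ unitaryGroup (Fin 2) ℂ) (hc : star c * c = 1)
    (hW : (W₂ * W₁) 0 0 * (W₂ * W₁) 0 1 = 0) :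
    ForgetsAfter ((V₁ ⊗ₖ W₁) * phaseSwap c * (V₂ ⊗ₖ W₂)) 2 := by
  have hU := phaseSwapForm_mem_unitaryGroup hV₁ hW₁ hV₂ hW₂ hc
  refine forgetsAfter_two hU fun ρ σ X hσ hX => ?_
  rw [concurrentChannel_phaseSwapForm hV₁ hW₂ hc ρ (by rw [trace_concurrentChannel hU hσ, hX]),
    concurrentChannel_phaseSwapForm_apply_zero_zero hV₁ hW₂ hc σ hX]
  rcases mul_eq_zero.1 hW with h | h <;> simp [h]

/-- If `W₂ W₁` is neither diagonal nor antidiagonal, some constant input keeps the initial memory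
state alive forever. -/
lemma not_forgetsAfter_phaseSwapForm (hV₁ : V₁ ∈ unitaryGroup (Fin 2) ℂ)
    (hW₁ : W₁ ∈ unitaryGroup (Fin 2) ℂ) (hV₂ : V₂ ∈ unitaryGroup (Fin 2) ℂ)
    (hW₂ : W₂ ∈ unitaryGroup (Fin 2) ℂ) (hc : star c * c = 1) (hc2 : c ^ 2 ≠ 1)
    (hW : (W₂ * W₁) 0 0 * (W₂ * W₁) 0 1 ≠ 0) (Δ : ℕ) :
    ¬ ForgetsAfter ((V₁ ⊗ₖ W₁) * phaseSwap c * (V₂ ⊗ₖ W₂)) Δ := fun h => by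
  have hU := phaseSwapForm_mem_unitaryGroup hV₁ hW₁ hV₂ hW₂ hc
  set z : ℂ := (W₂ * W₁) 0 0 * star ((W₂ * W₁) 0 1) with hz
  have hz0 : z ≠ 0 := by
    rw [hz]
    exact mul_ne_zero (left_ne_zero_of_mul hW) (star_ne_zero.2 (right_ne_zero_of_mul hW))
  have hn0 : (‖z‖ : ℂ) ≠ 0 := by simpa using hz0
  have hzz : star z * z = (‖z‖ : ℂ) ^ 2 := by rw [star_def, conj_mul']
  -- The phase of the input coherence is chosen to make the factor of one run nonzero.
  set r : ℂ := I * star z / ‖z‖ with hr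
  have hrz : z * r = I * ‖z‖ := by
    rw [hr, mul_div_assoc', div_eq_iff hn0]; linear_combination I * hzz
  have hsr : star z * star r = -I * ‖z‖ := by
    rw [← star_mul', hrz]; simp
  have hr1 : star r * r = 1 := by
    have h1 : (star r * r) * (‖z‖ : ℂ) ^ 2 = 1 * (‖z‖ : ℂ) ^ 2 := by
      have : (z * r) * (star z * star r) = (‖z‖ : ℂ) ^ 2 := by
        rw [hrz, hsr]; linear_combination -(‖z‖ : ℂ) ^ 2 * I_sq
      rw [one_mul]; linear_combination this - star r * r * hzz
    exact mul_right_cancel₀ (pow_ne_zero 2 hn0) h1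
  have hρ := (isState_equatorState hr1).conj hV₂
  have h0 := memoryState_eq_of_forgetsAfter_phaseSwapForm hV₁ hW₁ hV₂ hW₂ hc h hρ
  have hne : ∀ n, (memoryState ((V₁ ⊗ₖ W₁) * phaseSwap c * (V₂ ⊗ₖ W₂))
      (fun _ => V₂ᴴ * equatorState r * V₂) (W₂ᴴ * pauli 2 * W₂) n).trace = 0 ∧
      (W₂ * memoryState ((V₁ ⊗ₖ W₁) * phaseSwap c * (V₂ ⊗ₖ W₂))
      (fun _ => V₂ᴴ * equatorState r * V₂) (W₂ᴴ * pauli 2 * W₂) n * W₂ᴴ) 0 0 ≠ 0 := by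
    intro n
    induction n with
    | zero =>
      refine ⟨trace_conj_pauli_two hW₂, ?_⟩
      rw [memoryState, conj_conjTranspose_conj hW₂]
      simp [pauli]
    | succ n ih =>
      rw [memoryState]
      refine ⟨by rw [trace_concurrentChannel hU hρ, ih.1], ?_⟩
      rw [concurrentChannel_phaseSwapForm_apply_zero_zero hV₁ hW₂ hc _ ih.1,
        conj_conjTranspose_conj hV₂, ← hz]
      refine mul_ne_zero ih.2 (mul_ne_zero ((star_sub_self_eq_zero_iff hc).not.2 hc2) ?_)
      have : star ((W₂ * W₁) 0 0) * (W₂ * W₁) 0 1 = star z := by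
        rw [hz, star_mul', star_star]
      have h2 : z * equatorState r 0 1 - star z * equatorState r 1 0 = I * ‖z‖ := by
        simp only [equatorState, Matrix.of_apply, cons_val', cons_val_zero, cons_val_one,
          cons_val_fin_one]
        linear_combination hrz / 2 - hsr / 2
      rw [this, h2]
      exact mul_ne_zero I_ne_zero hn0
  apply (hne Δ).2
  rw [h0, Matrix.mul_zero, Matrix.zero_mul]
  rfl

end PhaseSwap

/-! ### The canonical gates -/

section Gates

lemma finiteDepthGate_eq_phaseSwap (α : ℝ) (hx hy : Fin 2) :
    finiteDepthGate α hx hy = phaseSwap (I * Complex.exp (-2 * I * α)) *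
      ((pauli 0 ^ (hx : ℕ) * pauli 1 ^ (hy : ℕ)) ⊗ₖ (pauli 0 ^ (hx : ℕ) * pauli 1 ^ (hy : ℕ))) := by
  have h1 : (1 / 2 : ℂ) • (1 + pauliPair 2 +
      (I * Complex.exp (-2 * I * α)) • (pauliPair 0 + pauliPair 1)) =
      phaseSwap (I * Complex.exp (-2 * I * α)) := by
    generalize I * Complex.exp (-2 * I * α) = c
    ext ⟨i, a⟩ ⟨j, b⟩
    simp only [pauliPair, phaseSwap, Matrix.smul_apply, Matrix.add_apply, kroneckerMap_apply,
      Matrix.of_apply, Matrix.one_apply, Prod.mk.injEq, smul_eq_mul]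
    fin_cases i <;> fin_cases a <;> fin_cases j <;> fin_cases b <;> simp [pauli] <;> ring
  have h2 : ∀ (j : Fin 3) (h : Fin 2), pauliPair j ^ (h : ℕ) =
      (pauli j ^ (h : ℕ)) ⊗ₖ (pauli j ^ (h : ℕ)) := by
    intro j h
    fin_cases h <;> simp [pauliPair]
  rw [finiteDepthGate, h1, h2, h2, Matrix.mul_assoc, mul_kronecker_mul]

/-- The phase of the canonical gate on a Bell state. The four unnormalized Bell states are the
columns of `bellMatrix`. -/
noncomputable def bellPhase (α : Fin 3 → ℝ) (p : Fin 2 × Fin 2) : ℂ :=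
  !![(α 0 : ℂ) - α 1 + α 2, α 0 + α 1 - α 2; -α 0 - α 1 - α 2, -α 0 + α 1 + α 2] p.1 p.2

/-- The columns are `|00⟩ + |11⟩`, `|01⟩ + |10⟩`, `|01⟩ - |10⟩` and `|00⟩ - |11⟩`, numbered by
`00`, `01`, `10` and `11`. -/
def bellMatrix : TwoQubitOp :=
  Matrix.of fun p q =>
    if p = q then (if p.1 = 0 then 1 else -1) else (if p.1 ≠ q.1 ∧ p.2 ≠ q.2 then 1 else 0)

lemma bellMatrix_mul_self : bellMatrix * bellMatrix = (2 : ℂ) • 1 := by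
  ext ⟨i, a⟩ ⟨j, b⟩
  simp only [bellMatrix, Matrix.mul_apply, Fintype.sum_prod_type, Fin.sum_univ_two,
    Matrix.of_apply, Matrix.smul_apply, Matrix.one_apply, Prod.mk.injEq]
  fin_cases i <;> fin_cases a <;> fin_cases j <;> fin_cases b <;> simp <;> norm_num

lemma canonicalGate_eq_bellMatrix (α : Fin 3 → ℝ) :
    canonicalGate α =
      bellMatrix * diagonal (fun p => Complex.exp (I * bellPhase α p)) *
        ((1 / 2 : ℂ) • bellMatrix) := by
  have hinv : bellMatrix * ((1 / 2 : ℂ) • bellMatrix) = 1 := by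
    rw [Matrix.mul_smul, bellMatrix_mul_self, smul_smul]; norm_num
  have hunit : IsUnit bellMatrix := IsUnit.of_mul_eq_one _ hinv
  have h : I • ∑ j, (α j : ℂ) • pauliPair j =
      bellMatrix * diagonal (fun p => I * bellPhase α p) * bellMatrix⁻¹ := by
    rw [Matrix.inv_eq_right_inv hinv]
    ext ⟨i, a⟩ ⟨j, b⟩
    simp only [Fin.sum_univ_three, pauliPair, Matrix.smul_apply, Matrix.add_apply,
      kroneckerMap_apply, smul_eq_mul, Matrix.mul_apply, Fintype.sum_prod_type,
      Fin.sum_univ_two]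
    fin_cases i <;> fin_cases a <;> fin_cases j <;> fin_cases b <;>
      simp [pauli, bellMatrix, bellPhase] <;> ring
  rw [canonicalGate, h, Matrix.exp_conj _ _ hunit, Matrix.exp_diagonal,
    Matrix.inv_eq_right_inv hinv]
  congr 3
  ext p
  rw [Pi.coe_exp, Complex.exp_eq_exp_ℂ]

lemma canonicalGate_eq_finiteDepthGate (α : Fin 3 → ℝ)
    (h0 : α 0 = Real.pi / 4 ∨ α 0 = -(Real.pi / 4))
    (h1 : α 1 = Real.pi / 4 ∨ α 1 = -(Real.pi / 4)) :
    canonicalGate α =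
      (Complex.exp (I * α 2) * (-I) ^ ((negStep (α 0) : ℕ) + (negStep (α 1) : ℕ))) •
        finiteDepthGate (α 2) (negStep (α 0)) (negStep (α 1)) := by
  have hpos : negStep (Real.pi / 4) = 0 := by
    rw [negStep, if_neg]; linarith [Real.pi_pos]
  have hneg : negStep (-(Real.pi / 4)) = 1 := by
    rw [negStep, if_pos]; linarith [Real.pi_pos]
  have hI : ∀ z : ℂ, Complex.exp (I * (Real.pi / 2 + z)) = I * Complex.exp (I * z) := fun z => by
    rw [mul_add, Complex.exp_add, mul_comm I, Complex.exp_pi_div_two_mul_I]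
  have hI' : ∀ z : ℂ, Complex.exp (I * (-(Real.pi / 2) + z)) = -I * Complex.exp (I * z) :=
    fun z => by
      have h := hI (-(Real.pi / 2) + z)
      rw [add_neg_cancel_left] at h
      linear_combination I * h + Complex.exp (I * (-(Real.pi / 2) + z)) * I_sq
  have he : Complex.exp (I * α 2) * Complex.exp (-2 * I * α 2) = Complex.exp (I * -α 2) := by
    rw [← Complex.exp_add]; congr 1; ring
  rw [canonicalGate_eq_bellMatrix, finiteDepthGate_eq_phaseSwap]
  have hbell : ∀ w x y z : ℂ, (α 0 : ℂ) - α 1 + α 2 = w → (α 0 : ℂ) + α 1 - α 2 = x →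
      -(α 0 : ℂ) - α 1 - α 2 = y → -(α 0 : ℂ) + α 1 + α 2 = z →
      (fun p => Complex.exp (I * bellPhase α p)) = fun p : Fin 2 × Fin 2 =>
        !![Complex.exp (I * w), Complex.exp (I * x); Complex.exp (I * y), Complex.exp (I * z)]
          p.1 p.2 := by
    rintro w x y z rfl rfl rfl rfl
    ext ⟨i, a⟩
    fin_cases i <;> fin_cases a <;> rfl
  rcases h0 with h0 | h0 <;> rcases h1 with h1 | h1
  · rw [hbell (α 2) (Real.pi / 2 + -α 2) (-(Real.pi / 2) + -α 2) (α 2)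
      (by rw [h0, h1]; push_cast; ring) (by rw [h0, h1]; push_cast; ring)
      (by rw [h0, h1]; push_cast; ring) (by rw [h0, h1]; push_cast; ring), hI, hI']
    rw [h0, h1, hpos, ← he]
    ext ⟨i, a⟩ ⟨j, b⟩
    simp only [Matrix.smul_apply, smul_eq_mul, Matrix.mul_apply, Fintype.sum_prod_type,
      Fin.sum_univ_two, kroneckerMap_apply]
    fin_cases i <;> fin_cases a <;> fin_cases j <;> fin_cases b <;>
      simp [bellMatrix, phaseSwap] <;> ring
  · rw [hbell (Real.pi / 2 + α 2) (-α 2) (-α 2) (-(Real.pi / 2) + α 2)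
      (by rw [h0, h1]; push_cast; ring) (by rw [h0, h1]; push_cast; ring)
      (by rw [h0, h1]; push_cast; ring) (by rw [h0, h1]; push_cast; ring), hI, hI']
    rw [h0, h1, hpos, hneg, ← he]
    ext ⟨i, a⟩ ⟨j, b⟩
    simp only [Matrix.smul_apply, smul_eq_mul, Matrix.mul_apply, Fintype.sum_prod_type,
      Fin.sum_univ_two, kroneckerMap_apply]
    fin_cases i <;> fin_cases a <;> fin_cases j <;> fin_cases b <;>
      simp [bellMatrix, phaseSwap, pauli] <;> ring_nf <;> simp
  · rw [hbell (-(Real.pi / 2) + α 2) (-α 2) (-α 2) (Real.pi / 2 + α 2)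
      (by rw [h0, h1]; push_cast; ring) (by rw [h0, h1]; push_cast; ring)
      (by rw [h0, h1]; push_cast; ring) (by rw [h0, h1]; push_cast; ring), hI, hI']
    rw [h0, h1, hpos, hneg, ← he]
    ext ⟨i, a⟩ ⟨j, b⟩
    simp only [Matrix.smul_apply, smul_eq_mul, Matrix.mul_apply, Fintype.sum_prod_type,
      Fin.sum_univ_two, kroneckerMap_apply]
    fin_cases i <;> fin_cases a <;> fin_cases j <;> fin_cases b <;>
      simp [bellMatrix, phaseSwap, pauli] <;> ring_nf <;> simp
  · rw [hbell (α 2) (-(Real.pi / 2) + -α 2) (Real.pi / 2 + -α 2) (α 2)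
      (by rw [h0, h1]; push_cast; ring) (by rw [h0, h1]; push_cast; ring)
      (by rw [h0, h1]; push_cast; ring) (by rw [h0, h1]; push_cast; ring), hI, hI']
    rw [h0, h1, hneg, ← he]
    ext ⟨i, a⟩ ⟨j, b⟩
    simp only [Matrix.smul_apply, smul_eq_mul, Matrix.mul_apply, Fintype.sum_prod_type,
      Fin.sum_univ_two, kroneckerMap_apply]
    fin_cases i <;> fin_cases a <;> fin_cases j <;> fin_cases b <;>
      simp [bellMatrix, phaseSwap, pauli] <;> ring_nf

/-- Rotation of the Bloch ball by `2π/3` about the axis `(1, 1, 1)`. -/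
noncomputable def axisRotation : QubitOp :=
  (1 / 2 : ℂ) • !![1 - I, -1 - I; 1 - I, 1 + I]

lemma axisRotation_mem_unitaryGroup : axisRotation ∈ unitaryGroup (Fin 2) ℂ := by
  rw [mem_unitaryGroup_iff']
  ext i j
  simp only [axisRotation, star_eq_conjTranspose, Matrix.mul_apply, Fin.sum_univ_two,
    conjTranspose_apply, Matrix.smul_apply]
  fin_cases i <;> fin_cases j <;> simp <;> ring_nf <;> simp <;> norm_num

lemma axisRotation_conj_pauli (j : Fin 3) :
    axisRotation * pauli j * axisRotationᴴ = pauli (j + 1) := by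
  ext a b
  simp only [axisRotation, Matrix.mul_apply, Fin.sum_univ_two, conjTranspose_apply,
    Matrix.smul_apply]
  fin_cases j <;> fin_cases a <;> fin_cases b <;> simp [pauli] <;> ring_nf <;> simp <;> norm_num

lemma canonicalGate_shift (α : Fin 3 → ℝ) :
    canonicalGate α = (axisRotation ⊗ₖ axisRotation) * canonicalGate (fun j => α (j + 1)) *
      (axisRotationᴴ ⊗ₖ axisRotationᴴ) := by
  set T := axisRotation
  have hT := kronecker_mem_unitary axisRotation_mem_unitaryGroup axisRotation_mem_unitaryGroup
  have hinv : (T ⊗ₖ T)⁻¹ = Tᴴ ⊗ₖ Tᴴ := by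
    rw [← conjTranspose_kronecker]
    exact Matrix.inv_eq_right_inv (self_mul_conjTranspose_of_mem hT)
  have hpair : ∀ j, (T ⊗ₖ T) * pauliPair j * (Tᴴ ⊗ₖ Tᴴ) = pauliPair (j + 1) := fun j => by
    rw [pauliPair, ← mul_kronecker_mul, ← mul_kronecker_mul, axisRotation_conj_pauli]; rfl
  have hsum : I • ∑ j, (α j : ℂ) • pauliPair j =
      (T ⊗ₖ T) * (I • ∑ j, (α (j + 1) : ℂ) • pauliPair j) * (T ⊗ₖ T)⁻¹ := by
    rw [hinv, Matrix.mul_smul, Matrix.smul_mul, Matrix.mul_sum, Matrix.sum_mul]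
    simp only [Matrix.mul_smul, Matrix.smul_mul, hpair]
    rw [← Equiv.sum_comp (Equiv.addRight (1 : Fin 3))]
    rfl
  rw [canonicalGate, hsum, Matrix.exp_conj _ _
    (IsUnit.of_mul_eq_one _ (self_mul_conjTranspose_of_mem hT)), hinv]
  rfl

end Gates

/-! ### Values of the memory depth -/

section MemoryDepth

lemma traceMem_kronecker {S M : Type*} [Fintype M] (A : Matrix S S ℂ) (B : Matrix M M ℂ) :
    traceMem (A ⊗ₖ B) = B.trace • A := by
  ext i j
  simp [traceMem, Matrix.trace, ← Finset.mul_sum, mul_comm]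

variable {S M : Type*} [Fintype S] [Fintype M]

lemma memoryDepth_eq_coe {U : Matrix (S × M) (S × M) ℂ} {n : ℕ} (h : ForgetsAfter U n)
    (hlt : ∀ m < n, ¬ ForgetsAfter U m) : memoryDepth U = n := by
  refine le_antisymm (sInf_le ⟨n, rfl, h⟩) (le_sInf ?_)
  rintro _ ⟨m, rfl, hm⟩
  exact Nat.cast_le.2 (not_lt.1 fun hmn => hlt m hmn hm)

lemma memoryDepth_eq_top {U : Matrix (S × M) (S × M) ℂ} (h : ∀ n, ¬ ForgetsAfter U n) :
    memoryDepth U = ⊤ := by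
  refine sInf_eq_top.2 ?_
  rintro _ ⟨m, rfl, hm⟩
  exact absurd hm (h m)

end MemoryDepth

/-! ### Depth of the normal forms -/

section Families

lemma IsFactorized.memoryDepth_eq_zero {U : TwoQubitOp} (h : IsFactorized U) :
    memoryDepth U = 0 := by
  obtain ⟨V, hV, W, hW, rfl⟩ := h
  refine memoryDepth_eq_coe (n := 0) ?_ fun m hm => absurd hm (Nat.not_lt_zero m)
  have hU := kronecker_mem_unitary hV hW
  intro n _ ρ ρ' ξ ξ' hρ hρ' hξ hξ' _
  have key : ∀ ζ : QubitOp, ∀ σ : QubitOp, systemChannel (V ⊗ₖ W) ζ σ = ζ.trace • (V * σ * Vᴴ) := by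
    intro ζ σ
    have : systemChannel (V ⊗ₖ W) ζ σ = _ := traceMem_kronecker_conj V hW (σ ⊗ₖ ζ)
    rw [this, traceMem_kronecker, Matrix.mul_smul, Matrix.smul_mul]
  refine LinearMap.ext fun σ => ?_
  rw [runChannel, runChannel, key, key, trace_memoryState hU hρ, trace_memoryState hU hρ', hξ.2,
    hξ'.2]

lemma swapGate_eq_phaseSwap : swapGate = phaseSwap 1 := by
  ext p q
  simp [swapGate, phaseSwap]

lemma phaseSwap_neg_one : phaseSwap (-1) = swapGate * (pauli 2 ⊗ₖ pauli 2) := by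
  rw [pauli_two_eq_diagonal, diagonal_kronecker_diagonal]
  ext ⟨i, a⟩ ⟨j, b⟩
  rw [mul_diagonal]
  fin_cases i <;> fin_cases a <;> fin_cases j <;> fin_cases b <;> simp [swapGate, phaseSwap]

lemma isLocallySwap_of_phaseSwap {V₁ V₂ W₁ W₂ : QubitOp} {c : ℂ}
    (hV₁ : V₁ ∈ unitaryGroup (Fin 2) ℂ) (hW₁ : W₁ ∈ unitaryGroup (Fin 2) ℂ)
    (hV₂ : V₂ ∈ unitaryGroup (Fin 2) ℂ) (hW₂ : W₂ ∈ unitaryGroup (Fin 2) ℂ) (hc : c ^ 2 = 1) :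
    IsLocallySwap ((V₁ ⊗ₖ W₁) * phaseSwap c * (V₂ ⊗ₖ W₂)) := by
  rcases mul_self_eq_one_iff.1 ((sq c).symm.trans hc) with rfl | rfl
  · exact ⟨V₁, hV₁, W₁, hW₁, V₂, hV₂, W₂, hW₂, by rw [swapGate_eq_phaseSwap]⟩
  · refine ⟨V₁, hV₁, W₁, hW₁, pauli 2 * V₂, mul_mem (pauli_mem_unitaryGroup 2) hV₂,
      pauli 2 * W₂, mul_mem (pauli_mem_unitaryGroup 2) hW₂, ?_⟩
    rw [phaseSwap_neg_one, mul_kronecker_mul]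
    simp only [Matrix.mul_assoc]

lemma IsLocallySwap.memoryDepth_eq_one {U : TwoQubitOp} (h : IsLocallySwap U) :
    memoryDepth U = 1 := by
  obtain ⟨V₁, hV₁, W₁, hW₁, V₂, hV₂, W₂, hW₂, rfl⟩ := h
  rw [swapGate_eq_phaseSwap]
  have hc : star (1 : ℂ) * 1 = 1 := by simp
  refine memoryDepth_eq_coe (n := 1)
    (forgetsAfter_one_phaseSwapForm hV₁ hW₁ hV₂ hW₂ hc (one_pow 2)) fun m hm => ?_
  rw [Nat.lt_one_iff.1 hm]
  exact not_forgetsAfter_zero_phaseSwapForm hV₁ hW₁ hV₂ hW₂ hc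

/-- Common normal form of the gates of depth two: a swap with a controlled phase `c ≠ ±1` whose
two local memory operations combine to a diagonal or antidiagonal unitary. -/
def IsMonomialPhaseSwap (U : TwoQubitOp) : Prop :=
  ∃ V₁ ∈ unitaryGroup (Fin 2) ℂ, ∃ W₁ ∈ unitaryGroup (Fin 2) ℂ,
  ∃ V₂ ∈ unitaryGroup (Fin 2) ℂ, ∃ W₂ ∈ unitaryGroup (Fin 2) ℂ, ∃ c : ℂ,
    star c * c = 1 ∧ c ^ 2 ≠ 1 ∧ (W₂ * W₁) 0 0 * (W₂ * W₁) 0 1 = 0 ∧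
    U = (V₁ ⊗ₖ W₁) * phaseSwap c * (V₂ ⊗ₖ W₂)

lemma IsMonomialPhaseSwap.memoryDepth_eq_two {U : TwoQubitOp} (h : IsMonomialPhaseSwap U) :
    memoryDepth U = 2 := by
  obtain ⟨V₁, hV₁, W₁, hW₁, V₂, hV₂, W₂, hW₂, c, hc, hc2, hW, rfl⟩ := h
  refine memoryDepth_eq_coe (n := 2) (forgetsAfter_two_phaseSwapForm hV₁ hW₁ hV₂ hW₂ hc hW)
    fun m hm => ?_
  interval_cases m
  · exact not_forgetsAfter_zero_phaseSwapForm hV₁ hW₁ hV₂ hW₂ hc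
  · exact not_forgetsAfter_one_phaseSwapForm hV₁ hW₁ hV₂ hW₂ hc hc2

lemma memoryDepth_eq_top_of_not {U : TwoQubitOp} (hU : U ∈ unitaryGroup (Fin 2 × Fin 2) ℂ)
    (h0 : ¬ IsFactorized U) (h1 : ¬ IsLocallySwap U) (h2 : ¬ IsMonomialPhaseSwap U) :
    memoryDepth U = ⊤ := by
  refine memoryDepth_eq_top fun Δ hΔ => ?_
  rcases hΔ.isFactorized_or_phaseSwap hU with
    h | ⟨V₁, hV₁, W₁, hW₁, V₂, hV₂, W₂, hW₂, c, hc, rfl⟩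
  · exact h0 h
  · by_cases hc2 : c ^ 2 = 1
    · exact h1 (isLocallySwap_of_phaseSwap hV₁ hW₁ hV₂ hW₂ hc2)
    · by_cases hW : (W₂ * W₁) 0 0 * (W₂ * W₁) 0 1 = 0
      · exact h2 ⟨V₁, hV₁, W₁, hW₁, V₂, hV₂, W₂, hW₂, c, hc, hc2, hW, rfl⟩
      · exact not_forgetsAfter_phaseSwapForm hV₁ hW₁ hV₂ hW₂ hc hc2 hW Δ hΔ

end Families

/-! ### Parametrizations of the gates of depth two -/

section Parametrization

lemma star_exp_I_mul (x : ℝ) : star (Complex.exp (I * x)) = Complex.exp (-(I * x)) := by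
  rw [star_def, ← Complex.exp_conj]; simp

lemma star_exp_I_mul_self (x : ℝ) :
    star (Complex.exp (I * x)) * Complex.exp (I * x) = 1 := by
  rw [star_exp_I_mul, ← Complex.exp_add, neg_add_cancel, Complex.exp_zero]

lemma exists_exp_I_mul {z : ℂ} (hz : star z * z = 1) : ∃ x : ℝ, z = Complex.exp (I * x) := by
  rw [star_def, conj_mul'] at hz
  have h1 : ‖z‖ = 1 :=
    (pow_eq_one_iff_of_nonneg (norm_nonneg z) two_ne_zero).1 (by exact_mod_cast hz)
  have h2 := norm_mul_exp_arg_mul_I z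
  rw [h1, ofReal_one, one_mul, mul_comm] at h2
  exact ⟨z.arg, h2.symm⟩

/-- The controlled phase of `finiteDepthGate α`. -/
lemma star_phase_mul_self (α : ℝ) :
    star (I * Complex.exp (-2 * I * α)) * (I * Complex.exp (-2 * I * α)) = 1 := by
  have h := star_exp_I_mul_self (-2 * α)
  have e : I * ((-2 * α : ℝ) : ℂ) = -2 * I * α := by push_cast; ring
  rw [e] at h
  rw [star_mul']
  simp only [star_def, conj_I] at h ⊢
  linear_combination h -
    (starRingEnd ℂ) (Complex.exp (-2 * I * α)) * Complex.exp (-2 * I * α) * I_sq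

lemma phase_sq_eq_one_iff (α : ℝ) :
    (I * Complex.exp (-2 * I * α)) ^ 2 = 1 ↔ Real.cos (2 * α) = 0 := by
  have h1 : Complex.exp (-2 * I * α) * Complex.exp (2 * I * α) = 1 := by
    rw [← Complex.exp_add]; simp
  have h2 : 2 * Complex.cos (2 * α) = Complex.exp (2 * I * α) + Complex.exp (-2 * I * α) := by
    rw [Complex.cos, mul_div_cancel₀ _ two_ne_zero]
    congr 2 <;> ring
  have h3 : (I * Complex.exp (-2 * I * α)) ^ 2 - 1 =
      -Complex.exp (-2 * I * α) * (2 * Complex.cos (2 * α)) := by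
    rw [h2]; linear_combination Complex.exp (-2 * I * α) ^ 2 * I_sq + h1
  rw [← sub_eq_zero, h3, mul_eq_zero, neg_eq_zero, mul_eq_zero]
  have : Complex.cos (2 * α) = (Real.cos (2 * α) : ℝ) := by push_cast; rfl
  rw [this, ofReal_eq_zero]
  simp only [Complex.exp_ne_zero, two_ne_zero, false_or]

lemma exists_phase_eq {c : ℂ} (hc : star c * c = 1) :
    ∃ α : ℝ, c = I * Complex.exp (-2 * I * α) := by
  obtain ⟨x, rfl⟩ := exists_exp_I_mul hc
  refine ⟨(Real.pi / 2 - x) / 2, ?_⟩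
  have : I * (x : ℂ) = Real.pi / 2 * I + -2 * I * (((Real.pi / 2 - x) / 2 : ℝ) : ℂ) := by
    push_cast; ring
  rw [this, Complex.exp_add, Complex.exp_pi_div_two_mul_I]

/-- A diagonal or antidiagonal unitary is a `memoryRotation` up to a phase. -/
lemma exists_eq_smul_memoryRotation {W : QubitOp} (hW : W ∈ unitaryGroup (Fin 2) ℂ)
    (h : W 0 0 * W 0 1 = 0) :
    ∃ μ : ℂ, star μ * μ = 1 ∧ ∃ p : Fin 2, ∃ β ∈ Set.Icc 0 (2 * Real.pi),
      W = μ • memoryRotation p β := by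
  have diag : ∀ u v : ℂ, star u * u = 1 → star v * v = 1 → ∃ μ : ℂ, star μ * μ = 1 ∧
      ∃ β ∈ Set.Icc 0 (2 * Real.pi),
        u = μ * Complex.exp (I * (β : ℝ)) ∧ v = μ * Complex.exp (-(I * (β : ℝ))) := by
    intro u v hu hv
    -- `β` is half the argument of `u / v`, shifted into `[0, 2π]`.
    set β : ℝ := (u * star v).arg / 2 + Real.pi
    have hb : Complex.exp (I * β) ^ 2 = u * star v := by
      have hn : ‖u * star v‖ = 1 := by
        rw [star_def, conj_mul'] at hu hv
        have h1 : ‖u‖ = 1 :=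
          (pow_eq_one_iff_of_nonneg (norm_nonneg u) two_ne_zero).1 (by exact_mod_cast hu)
        have h2 : ‖v‖ = 1 :=
          (pow_eq_one_iff_of_nonneg (norm_nonneg v) two_ne_zero).1 (by exact_mod_cast hv)
        rw [norm_mul, norm_star, h1, h2, one_mul]
      have e : ((2 : ℕ) : ℂ) * (I * β) = (u * star v).arg * I + 2 * Real.pi * I := by
        simp only [β]; push_cast; ring
      rw [← Complex.exp_nat_mul, e, Complex.exp_add, Complex.exp_two_pi_mul_I, mul_one]
      conv_rhs => rw [← norm_mul_exp_arg_mul_I (u * star v), hn]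
      simp
    have hE : Complex.exp (I * β) * Complex.exp (-(I * β)) = 1 := by
      rw [← Complex.exp_add, add_neg_cancel, Complex.exp_zero]
    refine ⟨v * Complex.exp (I * β), ?_, β, ⟨?_, ?_⟩, ?_, ?_⟩
    · have := star_exp_I_mul_self β
      rw [star_mul']
      linear_combination this * (star v * v) + hv
    · have := Complex.neg_pi_lt_arg (u * star v)
      simp only [β]; linarith [Real.pi_pos]
    · have := Complex.arg_le_pi (u * star v)
      simp only [β]; linarith [Real.pi_pos]
    · linear_combination -v * hb - u * hv
    · linear_combination -v * hE
  have hrow := self_mul_conjTranspose_of_mem hW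
  have r00 := congrFun (congrFun hrow 0) 0
  have r11 := congrFun (congrFun hrow 1) 1
  have c01 := congrFun (congrFun hrow 0) 1
  simp [Matrix.mul_apply, Fin.sum_univ_two] at r00 r11 c01
  rcases mul_eq_zero.1 h with h | h
  · have h01 : W 0 1 ≠ 0 := fun h' => by simp [h, h'] at r00
    have h11 : W 1 1 = 0 := by simpa [h, h01] using c01
    obtain ⟨μ, hμ, β, hβ, h1, h2⟩ := diag (-W 1 0) (W 0 1)
      (by simp [h11] at r11 ⊢; rw [mul_comm]; exact r11)
      (by simp [h] at r00 ⊢; rw [mul_comm]; exact r00)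
    refine ⟨μ, hμ, 1, β, hβ, ?_⟩
    ext i j
    fin_cases i <;> fin_cases j <;>
      simp [memoryRotation, h, h11, h2]
    linear_combination -h1
  · have h00 : W 0 0 ≠ 0 := fun h' => by simp [h, h'] at r00
    have h10 : W 1 0 = 0 := by simpa [h, h00] using c01
    obtain ⟨μ, hμ, β, hβ, h1, h2⟩ := diag (W 0 0) (W 1 1)
      (by simp [h] at r00 ⊢; rw [mul_comm]; exact r00)
      (by simp [h10] at r11 ⊢; rw [mul_comm]; exact r11)
    refine ⟨μ, hμ, 0, β, hβ, ?_⟩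
    ext i j
    fin_cases i <;> fin_cases j <;> simp [memoryRotation, h, h10, h1, h2]

lemma memoryRotation_mem_unitaryGroup (p : Fin 2) (β : ℝ) :
    memoryRotation p β ∈ unitaryGroup (Fin 2) ℂ := by
  refine mul_mem (pow_mem ?_ _) ?_
  · rw [mem_unitaryGroup_iff']
    ext i j
    fin_cases i <;> fin_cases j <;> simp [Matrix.mul_apply, star_eq_conjTranspose]
  · have h : (!![Complex.exp (I * β), 0; 0, Complex.exp (-(I * β))] : QubitOp) =
        diagonal ![Complex.exp (I * β), Complex.exp (-(I * β))] := by
      ext i j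
      fin_cases i <;> fin_cases j <;> simp
    rw [h, diagonal_mem_unitaryGroup]
    intro i
    fin_cases i
    · exact star_exp_I_mul_self β
    · have := star_exp_I_mul_self (-β)
      simpa using this

lemma memoryRotation_row (p : Fin 2) (β : ℝ) :
    memoryRotation p β 0 0 * memoryRotation p β 0 1 = 0 := by
  fin_cases p <;> simp [memoryRotation, Matrix.mul_apply, Fin.sum_univ_two]

lemma isMonomialPhaseSwap_of_finiteDepthGate {V₁ V₂ W₂ W' : QubitOp}
    (hV₁ : V₁ ∈ unitaryGroup (Fin 2) ℂ) (hV₂ : V₂ ∈ unitaryGroup (Fin 2) ℂ)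
    (hW₂ : W₂ ∈ unitaryGroup (Fin 2) ℂ) (hW' : W' ∈ unitaryGroup (Fin 2) ℂ)
    (hrow : W' 0 0 * W' 0 1 = 0) {α : ℝ} (hα : Real.cos (2 * α) ≠ 0) (hx hy : Fin 2) :
    IsMonomialPhaseSwap ((V₁ ⊗ₖ (W₂ᴴ * W')) * finiteDepthGate α hx hy * (V₂ ⊗ₖ W₂)) := by
  set P : QubitOp := pauli 0 ^ (hx : ℕ) * pauli 1 ^ (hy : ℕ) with hP
  have hPu : P ∈ unitaryGroup (Fin 2) ℂ :=
    mul_mem (pow_mem (pauli_mem_unitaryGroup 0) _) (pow_mem (pauli_mem_unitaryGroup 1) _)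
  -- The second row has a zero as well; the antidiagonal `σ_x` and `σ_y` exchange the rows.
  have hrow₁ : W' 1 0 * W' 1 1 = 0 := by
    have h1 := self_mul_conjTranspose_of_mem hW'
    have h01 := congrFun (congrFun h1 0) 1
    have h00 := congrFun (congrFun h1 0) 0
    simp [Matrix.mul_apply, Fin.sum_univ_two] at h01 h00
    rcases mul_eq_zero.1 hrow with h | h
    · have : W' 0 1 ≠ 0 := fun h' => by simp [h, h'] at h00
      simp [h, this] at h01
      rw [h01, mul_zero]
    · have : W' 0 0 ≠ 0 := fun h' => by simp [h, h'] at h00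
      simp [h, this] at h01
      rw [h01, zero_mul]
  refine ⟨V₁, hV₁, W₂ᴴ * W', mul_mem (conjTranspose_mem_unitaryGroup hW₂) hW', P * V₂,
    mul_mem hPu hV₂, P * W₂, mul_mem hPu hW₂, I * Complex.exp (-2 * I * α),
    star_phase_mul_self α, (phase_sq_eq_one_iff α).not.2 hα, ?_, ?_⟩
  · have : P * W₂ * (W₂ᴴ * W') = P * W' := by
      rw [Matrix.mul_assoc, ← Matrix.mul_assoc W₂, self_mul_conjTranspose_of_mem hW₂,
        Matrix.one_mul]
    rw [this, hP]
    fin_cases hx <;> fin_cases hy <;>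
      simp [pauli, Matrix.mul_apply, Fin.sum_univ_two] <;>
      first | simpa using hrow | simpa using hrow₁
  · rw [finiteDepthGate_eq_phaseSwap, ← hP, mul_kronecker_mul P]
    simp only [Matrix.mul_assoc]

lemma isDepthTwoForm_iff {U : TwoQubitOp} : IsDepthTwoForm U ↔ IsMonomialPhaseSwap U := by
  constructor
  · rintro ⟨V₁, hV₁, V₂, hV₂, W₂, hW₂, α, hx, hy, p, β, -, hα, rfl⟩
    exact isMonomialPhaseSwap_of_finiteDepthGate hV₁ hV₂ hW₂ (memoryRotation_mem_unitaryGroup p β)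
      (memoryRotation_row p β) hα hx hy
  · rintro ⟨V₁, hV₁, W₁, hW₁, V₂, hV₂, W₂, hW₂, c, hc, hc2, hW, rfl⟩
    obtain ⟨α, rfl⟩ := exists_phase_eq hc
    obtain ⟨μ, hμ, p, β, hβ, hμW⟩ := exists_eq_smul_memoryRotation (mul_mem hW₂ hW₁) hW
    refine ⟨μ • V₁, smul_mem_unitaryGroup hV₁ hμ, V₂, hV₂, W₂, hW₂, α, 0, 0, p, β, hβ,
      (phase_sq_eq_one_iff α).not.1 hc2, ?_⟩
    have hW₁' : W₁ = μ • (W₂ᴴ * memoryRotation p β) := by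
      rw [← Matrix.mul_smul, ← hμW, ← Matrix.mul_assoc, conjTranspose_mul_self_of_mem hW₂,
        Matrix.one_mul]
    rw [finiteDepthGate_eq_phaseSwap, hW₁', kronecker_smul, smul_kronecker]
    simp

/-- The form of `IsDepthTwoExpForm` with the distinguished axis `k` prescribed. -/
def IsExpFormAlong (k : Fin 3) (U : TwoQubitOp) : Prop :=
  ∃ V₁ ∈ unitaryGroup (Fin 2) ℂ, ∃ V₂ ∈ unitaryGroup (Fin 2) ℂ,
  ∃ W₂ ∈ unitaryGroup (Fin 2) ℂ, ∃ W' ∈ unitaryGroup (Fin 2) ℂ, ∃ α : Fin 3 → ℝ,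
    (∀ j, j ≠ k → α j = Real.pi / 4 ∨ α j = -(Real.pi / 4)) ∧
    Real.cos (2 * α k) ≠ 0 ∧
    (W' * pauli k * W'ᴴ = pauli k ∨ W' * pauli k * W'ᴴ = -pauli k) ∧
    U = (V₁ ⊗ₖ (W₂ᴴ * W')) * canonicalGate α * (V₂ ⊗ₖ W₂)

/-- Conjugating all local unitaries with `axisRotation` moves the distinguished axis. -/
lemma IsExpFormAlong.shift {k : Fin 3} {U : TwoQubitOp} (h : IsExpFormAlong (k + 1) U) :
    IsExpFormAlong k U := by
  obtain ⟨V₁, hV₁, V₂, hV₂, W₂, hW₂, W', hW', α, hα, hk, hσ, rfl⟩ := h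
  have hT := axisRotation_mem_unitaryGroup
  have hT' := conjTranspose_mem_unitaryGroup hT
  have hT1 := conjTranspose_mul_self_of_mem hT
  have hT2 := self_mul_conjTranspose_of_mem hT
  have hback := mul_conjTranspose_cancel hT (axisRotation_conj_pauli k).symm
  have hconj := axisRotation_conj_pauli k
  have hshift := canonicalGate_shift α
  set T := axisRotation
  refine ⟨V₁ * T, mul_mem hV₁ hT, Tᴴ * V₂, mul_mem hT' hV₂, Tᴴ * W₂, mul_mem hT' hW₂,
    Tᴴ * W' * T, mul_mem (mul_mem hT' hW') hT, fun j => α (j + 1),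
    fun j hj => hα (j + 1) fun h => hj (add_right_cancel h), hk, ?_, ?_⟩
  · have e : Tᴴ * W' * T * pauli k * (Tᴴ * W' * T)ᴴ = Tᴴ * (W' * pauli (k + 1) * W'ᴴ) * T := by
      rw [← hconj, conjTranspose_mul, conjTranspose_mul, conjTranspose_conjTranspose]
      simp only [Matrix.mul_assoc]
    rw [e]
    rcases hσ with h | h
    · left; rw [h, hback]
    · right; rw [h, Matrix.mul_neg, Matrix.neg_mul, hback]
  · have e : (Tᴴ * W₂)ᴴ * (Tᴴ * W' * T) = W₂ᴴ * W' * T := by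
      rw [conjTranspose_mul, conjTranspose_conjTranspose]
      calc _ = W₂ᴴ * (T * Tᴴ) * W' * T := by simp only [Matrix.mul_assoc]
        _ = _ := by rw [hT2, Matrix.mul_one]
    rw [hshift, e, mul_kronecker_mul, mul_kronecker_mul]
    simp only [Matrix.mul_assoc]

lemma IsExpFormAlong.isMonomialPhaseSwap {U : TwoQubitOp} (h : IsExpFormAlong 2 U) :
    IsMonomialPhaseSwap U := by
  obtain ⟨V₁, hV₁, V₂, hV₂, W₂, hW₂, W', hW', α, hα, hk, hσ, rfl⟩ := h
  rw [canonicalGate_eq_finiteDepthGate α (hα 0 (by decide)) (hα 1 (by decide))]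
  set z : ℂ := Complex.exp (I * α 2) * (-I) ^ ((negStep (α 0) : ℕ) + (negStep (α 1) : ℕ)) with hz
  have hzu : star z * z = 1 := by
    have h1 := star_exp_I_mul_self (α 2)
    have h2 : ∀ n : ℕ, star ((-I) ^ n) * (-I) ^ n = 1 := fun n => by
      rw [star_pow, ← mul_pow]; simp
    rw [hz, star_mul']
    linear_combination h1 * (star ((-I) ^ ((negStep (α 0) : ℕ) + (negStep (α 1) : ℕ))) *
      (-I) ^ ((negStep (α 0) : ℕ) + (negStep (α 1) : ℕ))) + h2 _
  have hrow : W' 0 0 * W' 0 1 = 0 := by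
    have key : ∀ s : ℂ, W' * pauli 2 * W'ᴴ = s • pauli 2 → W' * pauli 2 = s • pauli 2 * W' := by
      intro s hs
      rw [← hs, Matrix.mul_assoc, conjTranspose_mul_self_of_mem hW', Matrix.mul_one]
    rcases hσ with h | h
    · have := congrFun (congrFun (key 1 (by rw [h, one_smul])) 0) 1
      simp [pauli, Matrix.mul_apply, Fin.sum_univ_two] at this
      have h01 : W' 0 1 = 0 := by linear_combination -this / 2
      rw [h01, mul_zero]
    · have := congrFun (congrFun (key (-1) (by rw [h, neg_one_smul])) 0) 0
      simp [pauli, Matrix.mul_apply, Fin.sum_univ_two] at this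
      have h00 : W' 0 0 = 0 := by linear_combination this / 2
      rw [h00, zero_mul]
  have := isMonomialPhaseSwap_of_finiteDepthGate (smul_mem_unitaryGroup hV₁ hzu) hV₂ hW₂ hW' hrow
    hk (negStep (α 0)) (negStep (α 1))
  rw [smul_kronecker] at this
  rwa [Matrix.mul_smul, ← Matrix.smul_mul]

lemma isDepthTwoExpForm_iff {U : TwoQubitOp} : IsDepthTwoExpForm U ↔ IsMonomialPhaseSwap U := by
  constructor
  · rintro ⟨V₁, hV₁, V₂, hV₂, W₂, hW₂, W', hW', α, k, hα, hk, hσ, hU⟩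
    have h : IsExpFormAlong k U := ⟨V₁, hV₁, V₂, hV₂, W₂, hW₂, W', hW', α, hα, hk, hσ, hU⟩
    -- The axis `x` follows the axis `z` cyclically, and `y` follows `x`.
    have h0 : ∀ {U}, IsExpFormAlong 0 U → IsExpFormAlong 2 U := fun h => IsExpFormAlong.shift h
    have h1 : ∀ {U}, IsExpFormAlong 1 U → IsExpFormAlong 0 U := fun h => IsExpFormAlong.shift h
    fin_cases k
    · exact (h0 h).isMonomialPhaseSwap
    · exact (h0 (h1 h)).isMonomialPhaseSwap
    · exact h.isMonomialPhaseSwap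
  · rintro ⟨V₁, hV₁, W₁, hW₁, V₂, hV₂, W₂, hW₂, c, hc, hc2, hW, rfl⟩
    obtain ⟨α, rfl⟩ := exists_phase_eq hc
    have hWW := mul_mem hW₂ hW₁
    have hzu := star_exp_I_mul_self (-α)
    refine ⟨Complex.exp (I * (-α : ℝ)) • V₁, smul_mem_unitaryGroup hV₁ hzu, V₂, hV₂, W₂, hW₂,
      W₂ * W₁, hWW, ![Real.pi / 4, Real.pi / 4, α], 2, ?_, ?_, ?_, ?_⟩
    · intro j hj
      fin_cases j
      · exact Or.inl rfl
      · exact Or.inl rfl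
      · exact absurd rfl hj
    · exact (phase_sq_eq_one_iff α).not.1 hc2
    · have hc1 : ∀ s : ℂ, W₂ * W₁ * pauli 2 = s • pauli 2 * (W₂ * W₁) →
          W₂ * W₁ * pauli 2 * (W₂ * W₁)ᴴ = s • pauli 2 := fun s hs => by
        rw [hs, Matrix.mul_assoc, self_mul_conjTranspose_of_mem hWW, Matrix.mul_one]
      obtain ⟨μ, -, p, β, -, hμW⟩ := exists_eq_smul_memoryRotation hWW hW
      fin_cases p
      · left
        rw [← one_smul ℂ (pauli 2)]
        nth_rewrite 1 [one_smul]
        apply hc1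
        rw [hμW]
        ext i j
        fin_cases i <;> fin_cases j <;>
          simp [memoryRotation, pauli, Matrix.mul_apply, Fin.sum_univ_two]
      · right
        rw [← neg_one_smul ℂ (pauli 2)]
        apply hc1
        rw [hμW]
        ext i j
        fin_cases i <;> fin_cases j <;>
          simp [memoryRotation, pauli, Matrix.mul_apply, Fin.sum_univ_two]
    · have hstep : negStep (Real.pi / 4) = 0 := by
        rw [negStep, if_neg]; linarith [Real.pi_pos]
      rw [canonicalGate_eq_finiteDepthGate _ (Or.inl rfl) (Or.inl rfl)]
      simp only [cons_val_zero, cons_val_one, cons_val, hstep]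
      rw [finiteDepthGate_eq_phaseSwap, ← Matrix.mul_assoc W₂ᴴ, conjTranspose_mul_self_of_mem hW₂,
        Matrix.one_mul, smul_kronecker, Matrix.mul_smul, Matrix.smul_mul, Matrix.smul_mul,
        Matrix.smul_mul, smul_smul]
      have : Complex.exp (I * α) * Complex.exp (I * (-α : ℝ)) = 1 := by
        rw [← Complex.exp_add]; simp
      rw [Fin.val_zero, add_zero, pow_zero, mul_one, this, one_smul]
      simp

end Parametrization

/-! ### Classification of two-qubit unitaries by memory depth -/

theorem mainTheorem1 :
    Set.range (fun U : unitaryGroup (Fin 2 × Fin 2) ℂ => memoryDepth (U : TwoQubitOp)) =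
      {0, 1, 2, ⊤} ∧
    (∀ U ∈ unitaryGroup (Fin 2 × Fin 2) ℂ,
      (memoryDepth U = 0 ∨ memoryDepth U = 1 ∨ memoryDepth U = 2 ∨ memoryDepth U = ⊤) ∧
      (memoryDepth U = 0 ↔ IsFactorized U) ∧
      (memoryDepth U = 1 ↔ IsLocallySwap U) ∧
      (memoryDepth U = 2 ↔ IsDepthTwoForm U) ∧
      (memoryDepth U = 2 ↔ IsDepthTwoExpForm U) ∧
      (memoryDepth U = ⊤ ↔ ¬ IsFactorized U ∧ ¬ IsLocallySwap U ∧ ¬ IsDepthTwoForm U)) ∧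
    (∀ α : Fin 3 → ℝ,
      (α 0 = Real.pi / 4 ∨ α 0 = -(Real.pi / 4)) →
      (α 1 = Real.pi / 4 ∨ α 1 = -(Real.pi / 4)) →
      canonicalGate α =
        (Complex.exp (I * α 2) * (-I) ^ ((negStep (α 0) : ℕ) + (negStep (α 1) : ℕ))) •
          finiteDepthGate (α 2) (negStep (α 0)) (negStep (α 1))) := by
  have d10 : (1 : ℕ∞) ≠ 0 := one_ne_zero
  have d20 : (2 : ℕ∞) ≠ 0 := two_ne_zero
  have d21 : (2 : ℕ∞) ≠ 1 := by decide
  have dt0 : (⊤ : ℕ∞) ≠ 0 := ENat.top_ne_zero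
  have dt1 : (⊤ : ℕ∞) ≠ 1 := ENat.top_ne_one
  have dt2 : (⊤ : ℕ∞) ≠ 2 := ENat.top_ne_ofNat 2
  have key : ∀ U ∈ unitaryGroup (Fin 2 × Fin 2) ℂ,
      (memoryDepth U = 0 ∨ memoryDepth U = 1 ∨ memoryDepth U = 2 ∨ memoryDepth U = ⊤) ∧
      (memoryDepth U = 0 ↔ IsFactorized U) ∧
      (memoryDepth U = 1 ↔ IsLocallySwap U) ∧
      (memoryDepth U = 2 ↔ IsDepthTwoForm U) ∧
      (memoryDepth U = 2 ↔ IsDepthTwoExpForm U) ∧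
      (memoryDepth U = ⊤ ↔ ¬ IsFactorized U ∧ ¬ IsLocallySwap U ∧ ¬ IsDepthTwoForm U) := by
    intro U hU
    rw [isDepthTwoForm_iff, isDepthTwoExpForm_iff]
    have h0 : IsFactorized U → memoryDepth U = 0 := IsFactorized.memoryDepth_eq_zero
    have h1 : IsLocallySwap U → memoryDepth U = 1 := IsLocallySwap.memoryDepth_eq_one
    have h2 : IsMonomialPhaseSwap U → memoryDepth U = 2 := IsMonomialPhaseSwap.memoryDepth_eq_two
    have ht := memoryDepth_eq_top_of_not hU
    by_cases c0 : IsFactorized U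
    · have d := h0 c0
      have c1 : ¬ IsLocallySwap U := fun h => d10 ((h1 h).symm.trans d)
      have c2 : ¬ IsMonomialPhaseSwap U := fun h => d20 ((h2 h).symm.trans d)
      simp [d, c0, c1, c2]
    by_cases c1 : IsLocallySwap U
    · have d := h1 c1
      have c2 : ¬ IsMonomialPhaseSwap U := fun h => d21 ((h2 h).symm.trans d)
      simp [d, c0, c1, c2, d21.symm]
    by_cases c2 : IsMonomialPhaseSwap U
    · have d := h2 c2
      simp [d, c0, c1, c2, d21]
    · have d := ht c0 c1 c2
      simp [d, c0, c1, c2, dt2]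
  refine ⟨Set.Subset.antisymm ?_ ?_, key, canonicalGate_eq_finiteDepthGate⟩
  · rintro _ ⟨U, rfl⟩
    exact (key U U.2).1
  · have one := one_mem (unitaryGroup (Fin 2) ℂ)
    have hI : star I * I = 1 := by simp
    have hI2 : I ^ 2 ≠ 1 := by rw [I_sq]; norm_num
    rintro _ (rfl | rfl | rfl | rfl)
    · exact ⟨1, IsFactorized.memoryDepth_eq_zero ⟨1, one, 1, one, by simp⟩⟩
    · exact ⟨⟨swapGate, swapGate_mem_unitaryGroup⟩, IsLocallySwap.memoryDepth_eq_one
        ⟨1, one, 1, one, 1, one, 1, one, by simp⟩⟩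
    · exact ⟨⟨phaseSwap I, phaseSwap_mem_unitaryGroup hI⟩, IsMonomialPhaseSwap.memoryDepth_eq_two
        ⟨1, one, 1, one, 1, one, 1, one, I, hI, hI2, by simp, by simp⟩⟩
    · refine ⟨⟨_, phaseSwapForm_mem_unitaryGroup one axisRotation_mem_unitaryGroup one one hI⟩,
        memoryDepth_eq_top (not_forgetsAfter_phaseSwapForm one axisRotation_mem_unitaryGroup one one
          hI hI2 ?_)⟩
      -- `axisRotation` moves the `z`-axis to the `x`-axis, so it is not monomial.
      rw [Matrix.one_mul]
      have e : axisRotation 0 0 * axisRotation 0 1 = -1 / 2 := by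
        simp [axisRotation]
        linear_combination I_sq / 4
      rw [e]; norm_num
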